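/- Let $A, V, Q$ be real $n\times n$ matrices with $V$ symmetric positive semidefinite and $Q$ symmetric, and let $\alpha<0$. Let $w$ be an $\mathbb{R}^n$-valued Brownian motion with covariance $V$ per unit of time (so $w(t)-w(s)\sim N(0,(t-s)V)$ for $s\le t$), let $x_0$ be a (possibly degenerate) Gaussian random vector in $\mathbb{R}^n$ that is independent of $w$, and put $\Sigma_0=\mathbb{E}[x_0x_0^T]$. Let $x(t)$, $t\ge 0$, be the solution with continuous paths of the stochastic differential equation $$dx(t)=A\,x(t)\,dt+dw(t),\qquad x(0)=x_0,$$ and define the infinite-time cost $$J=\int_0^\infty e^{2\alpha t}\,x(t)^TQ\,x(t)\,dt .$$ Put $A_\alpha=A+\alpha I$ and assume that $A_\alpha$ is stable (Hurwitz), that is, all its eigenvalues have negative real part. Then the Lyapunov equation $$A_\alpha^T\bar X_\alpha^Q+\bar X_\alpha^QA_\alpha+Q=0$$ has a unique solution $\bar X_\alpha^Q$, the integral defining $J$ converges absolutely almost surely, $J$ is integrable, and $$\mathbb{E}[J]=\operatorname{tr}\left(\left(\Sigma_0-\frac{V}{2\alpha}\right)\bar X_\alpha^Q\right).$$ -/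

import Mathlib

open MeasureTheory ProbabilityTheory Matrix
open scoped NNReal

namespace LinearSDE

noncomputable section

/-- An `ℝⁿ`-valued Brownian motion with covariance `V` per unit of time: it starts at `0`, has
independent increments, its increment over `[s, t]` has law `N(0, (t - s) V)`, and its paths are
continuous (almost surely). -/
structure IsBrownianMotion {n : ℕ} {Ω : Type*} [MeasurableSpace Ω] (V : Matrix (Fin n) (Fin n) ℝ)
    (w : ℝ≥0 → Ω → Fin n → ℝ) (P : Measure Ω) : Prop where
  posSemidef : V.PosSemidef
  zero : ∀ᵐ ω ∂P, w 0 ω = 0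
  indep : HasIndepIncrements w P
  law : ∀ s t : ℝ≥0, s ≤ t →
    HasLaw (fun ω ↦ WithLp.toLp 2 (w t ω - w s ω))
      (multivariateGaussian 0 (((t : ℝ) - (s : ℝ)) • V)) P
  cont : ∀ᵐ ω ∂P, Continuous fun t ↦ w t ω

/-- The process `x` solves `dx(t) = A x(t) dt + dw(t)` for `t ≥ 0`: its paths are continuous, and
almost surely `x(t) = x(0) + ∫₀ᵗ A x(s) ds + w(t)` for all `t ≥ 0`. -/
structure IsSolution {n : ℕ} {Ω : Type*} [MeasurableSpace Ω] (A : Matrix (Fin n) (Fin n) ℝ)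
    (w x : ℝ≥0 → Ω → Fin n → ℝ) (P : Measure Ω) : Prop where
  aemeasurable : ∀ t, AEMeasurable (x t) P
  cont : ∀ᵐ ω ∂P, Continuous fun t ↦ x t ω
  eq : ∀ᵐ ω ∂P, ∀ t : ℝ≥0,
    x t ω = x 0 ω + (∫ s in (0 : ℝ)..t, A *ᵥ x s.toNNReal ω) + w t ω

/-- The matrix `E[y yᵀ]` of second moments of a random vector `y`. -/
def secondMoment {n : ℕ} {Ω : Type*} [MeasurableSpace Ω] (y : Ω → Fin n → ℝ) (P : Measure Ω) :
    Matrix (Fin n) (Fin n) ℝ :=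
  Matrix.of fun i j ↦ ∫ ω, y ω i * y ω j ∂P

/-- The integrand `e^{2αt} x(t)ᵀ Q x(t)` of the cost, at time `t ≥ 0`. -/
def runningCost {n : ℕ} {Ω : Type*} (α : ℝ) (Q : Matrix (Fin n) (Fin n) ℝ)
    (x : ℝ≥0 → Ω → Fin n → ℝ) (ω : Ω) (t : ℝ) : ℝ :=
  Real.exp (2 * α * t) * (x t.toNNReal ω ⬝ᵥ Q *ᵥ x t.toNNReal ω)

/-- The infinite-time cost `J = ∫₀^∞ e^{2αt} x(t)ᵀ Q x(t) dt`. -/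
def cost {n : ℕ} {Ω : Type*} (α : ℝ) (Q : Matrix (Fin n) (Fin n) ℝ)
    (x : ℝ≥0 → Ω → Fin n → ℝ) (ω : Ω) : ℝ :=
  ∫ t in Set.Ioi (0 : ℝ), runningCost α Q x ω t

/-- The matrix `A_α = A + α I`. -/
def shift {n : ℕ} (A : Matrix (Fin n) (Fin n) ℝ) (α : ℝ) : Matrix (Fin n) (Fin n) ℝ :=
  A + α • (1 : Matrix (Fin n) (Fin n) ℝ)

/-- A real square matrix is stable (Hurwitz) if all its complex eigenvalues have negative real
part. -/
def IsStable {n : ℕ} (A : Matrix (Fin n) (Fin n) ℝ) : Prop :=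
  ∀ z ∈ spectrum ℂ (A.map (algebraMap ℝ ℂ)), z.re < 0

/-- `X` solves the Lyapunov equation `Aᵀ X + X A + Q = 0`. -/
def SolvesLyapunov {n : ℕ} (A Q X : Matrix (Fin n) (Fin n) ℝ) : Prop :=
  Aᵀ * X + X * A + Q = 0

end

end LinearSDE

/-! Let S(t) = E[x(t)x(t)ᵀ]. The core is the Lyapunov differential equation S' = AS + SAᵀ + V,
obtained without Itô calculus. The process y = x - w is pathwise continuously differentiable with y'
= Ax, so the ordinary product rule and Fubini give E[yyᵀ] (`integral_sub_mul_sub`). The mixed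
moments E[ywᵀ] follow because x(s) is uncorrelated with later increments of w (`integral_x_mul_sub`,
`integral_sub_mul_w`). Adding E[wwᵀ] = tV yields `SecondOrderSolution.secondMoment_eq`.

If X solves the Lyapunov equation for A_α and Q, then e^{2αt} tr(XS(t)) has derivative
e^{2αt}(tr(XV) - tr(QS(t))). Integration over (0, ∞) gives the formula, provided that the integrals
converge and the boundary term at infinity vanishes. For Q = I the solution X is positive
semidefinite, which bounds the integral of e^{2αt} tr S(t) uniformly
(`integrableOn_exp_mul_trace_one`). A general Q is dominated by this case, which also gives absolute
convergence and justifies Fubini.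

Existence and uniqueness of X are linear algebra: A_αᵀ and -A_α have no common eigenvalue. -/

namespace LinearSDE

open Filter Topology Polynomial

variable {n : ℕ}

/-! ### Lyapunov equations and flows of stable matrices. -/

/-- Intertwining extends from a matrix to all polynomials in it. -/
lemma aeval_mul_eq_mul_aeval {R : Type*} [Ring R] [Algebra ℂ R] {a b x : R} (h : a * x = x * b)
    (p : ℂ[X]) : aeval a p * x = x * aeval b p := by
  induction p using Polynomial.induction_on' with
  | add p q hp hq => simp [add_mul, mul_add, hp, hq]
  | monomial k c =>
    have hk : a ^ k * x = x * b ^ k := by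
      have : SemiconjBy x b a := h.symm
      exact (this.pow_right k).symm
    rw [aeval_monomial, aeval_monomial, mul_assoc, hk, ← mul_assoc, Algebra.commutes, mul_assoc]

/-- Since Bᵀ X = X (-B), Cayley–Hamilton for Bᵀ gives 0 = p(Bᵀ) X = X p(-B), where p is the common
characteristic polynomial of B and Bᵀ. The matrix p(-B) is invertible: otherwise some k and -k would
both be eigenvalues of B, hence both have negative real part. -/
lemma IsStable.eq_zero_of_lyapunov {B : Matrix (Fin n) (Fin n) ℝ} (hB : IsStable B)
    {X : Matrix (Fin n) (Fin n) ℝ} (h : Bᵀ * X + X * B = 0) : X = 0 := by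
  rcases isEmpty_or_nonempty (Fin n) with hn | hn
  · exact Subsingleton.elim _ _
  set Bc := B.map (algebraMap ℝ ℂ) with hBc
  set Xc := X.map (algebraMap ℝ ℂ) with hXc
  have h1 : Bcᵀ * Xc = Xc * (-Bc) := by
    have : Bᵀ * X = X * (-B) := by rw [mul_neg]; exact eq_neg_of_add_eq_zero_left h
    have := congrArg (algebraMap ℝ ℂ).mapMatrix this
    rw [map_mul, map_mul, map_neg] at this
    exact this
  have h2 := aeval_mul_eq_mul_aeval h1 Bc.charpoly
  rw [← charpoly_transpose, aeval_self_charpoly, zero_mul, charpoly_transpose] at h2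
  have h3 : IsUnit (aeval (-Bc) Bc.charpoly) := by
    rw [← spectrum.zero_notMem_iff ℂ, spectrum.map_polynomial_aeval_of_nonempty]
    · rintro ⟨k, hk, hk0⟩
      have hk1 : (k : ℂ) ∈ spectrum ℂ Bc := by
        rw [Matrix.mem_spectrum_iff_isRoot_charpoly]; exact hk0
      have hk2 : -k ∈ spectrum ℂ Bc := by
        rw [← spectrum.neg_eq] at hk; simpa using hk
      have a1 := hB _ hk1
      have a2 := hB _ hk2
      simp at a2
      linarith
    · exact spectrum.nonempty_of_isAlgClosed_of_finiteDimensional ℂ _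
  have h4 : Xc = 0 := by
    obtain ⟨u, hu⟩ := h3
    rw [← hu] at h2
    simpa using h2.symm
  ext i j
  have := congrFun (congrFun h4 i) j
  simpa [hXc] using this

/-- The map X ↦ Bᵀ X + X B is injective on a finite-dimensional space, hence surjective. -/
lemma IsStable.existsUnique_solvesLyapunov {B : Matrix (Fin n) (Fin n) ℝ} (hB : IsStable B)
    (Q : Matrix (Fin n) (Fin n) ℝ) : ∃! X, SolvesLyapunov B Q X := by
  let L : Matrix (Fin n) (Fin n) ℝ →ₗ[ℝ] Matrix (Fin n) (Fin n) ℝ :=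
    LinearMap.mulLeft ℝ Bᵀ + LinearMap.mulRight ℝ B
  have hL : ∀ X, L X = Bᵀ * X + X * B := fun X ↦ by simp [L]
  have hinj : Function.Injective L := by
    rw [← LinearMap.ker_eq_bot, LinearMap.ker_eq_bot']
    intro X hX
    exact hB.eq_zero_of_lyapunov (by rw [← hL, hX])
  obtain ⟨X, hX⟩ := LinearMap.surjective_of_injective hinj (-Q)
  refine ⟨X, ?_, fun Y hY ↦ hinj ?_⟩
  · simp [SolvesLyapunov, ← hL, hX]
  · rw [hX, hL]
    exact eq_neg_of_add_eq_zero_left hY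

/-- A vector annihilated by a power of `f - μ` with `μ.re < 0` starts a decaying solution of
`u' = f u`. -/
lemma exists_decaying_flow_of_pow_apply_eq_zero {f : Module.End ℂ (Fin n → ℂ)} {μ : ℂ}
    (hμ : μ.re < 0) {k : ℕ} {v : Fin n → ℂ} (hv : ((f - algebraMap ℂ _ μ) ^ k) v = 0) :
    ∃ u : ℝ → Fin n → ℂ, (∀ t, HasDerivAt u (f (u t)) t) ∧ u 0 = v ∧ Tendsto u atTop (𝓝 0) := by
  set g := f - algebraMap ℂ (Module.End ℂ (Fin n → ℂ)) μ with hg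
  induction k generalizing v with
  | zero =>
    refine ⟨0, fun t ↦ by simp, ?_, tendsto_const_nhds⟩
    simpa using hv.symm
  | succ k ih =>
    -- This is e^{tg} v, whose series stops because g^(k+1) v = 0. Then e^{tμ} p(t) solves u' = (g +
    -- μ) u = f u, and it decays as a polynomial times e^{tμ}.
    let p : ℝ → Fin n → ℂ := fun t ↦ ∑ j ∈ Finset.range (k + 1),
      ((t ^ j / j.factorial : ℝ) : ℂ) • (g ^ j) v
    have hp : ∀ t, HasDerivAt p (g (p t)) t := by
      intro t
      have h1 : HasDerivAt p (∑ j ∈ Finset.range (k + 1),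
          ((j * t ^ (j - 1) / j.factorial : ℝ) : ℂ) • (g ^ j) v) t := by
        refine HasDerivAt.fun_sum fun j _ ↦ ?_
        exact (((hasDerivAt_pow j t).div_const _).ofReal_comp).smul_const _
      convert h1 using 1
      simp only [p, map_sum, map_smul]
      rw [Finset.sum_range_succ, Finset.sum_range_succ']
      have : g ((g ^ k) v) = 0 := by
        rw [pow_succ'] at hv; exact hv
      rw [this]
      simp only [smul_zero, add_zero, Nat.cast_zero, zero_mul, zero_div, Complex.ofReal_zero,
        zero_smul]
      refine Finset.sum_congr rfl fun j _ ↦ ?_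
      rw [pow_succ' g, Module.End.mul_apply]
      congr 2
      rw [Nat.factorial_succ]
      push_cast
      field_simp
    refine ⟨fun t ↦ Complex.exp (t * μ) • p t, fun t ↦ ?_, ?_, ?_⟩
    · have h2 : HasDerivAt (fun t : ℝ ↦ Complex.exp (t * μ)) (Complex.exp (t * μ) * μ) t := by
        have : HasDerivAt (fun t : ℝ ↦ (t : ℂ) * μ) μ t := by
          simpa using (Complex.ofRealCLM.hasDerivAt (x := t)).mul_const μ
        exact this.cexp
      convert! h2.smul (hp t) using 1
      simp only [hg, map_smul, LinearMap.sub_apply, Module.algebraMap_end_apply]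
      rw [smul_sub, mul_smul]
      abel
    · simp only [Complex.ofReal_zero, zero_mul, Complex.exp_zero, one_smul, p]
      rw [Finset.sum_range_succ']
      simp
    · simp only [p, Finset.smul_sum]
      rw [← Finset.sum_const_zero (ι := ℕ) (s := Finset.range (k + 1))]
      refine tendsto_finsetSum _ fun j _ ↦ ?_
      simp_rw [smul_smul]
      rw [← zero_smul ℂ ((g ^ j) v)]
      refine Tendsto.smul_const ?_ _
      rw [tendsto_zero_iff_norm_tendsto_zero]
      have h3 : Tendsto (fun t : ℝ ↦ t ^ j * Real.exp (-(-μ.re) * t)) atTop (𝓝 0) := by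
        have := tendsto_rpow_mul_exp_neg_mul_atTop_nhds_zero (j : ℝ) (-μ.re) (by linarith)
        simpa using this
      have h4 := h3.div_const (j.factorial : ℝ)
      rw [zero_div] at h4
      refine h4.congr' ?_
      filter_upwards [eventually_ge_atTop 0] with t ht
      rw [norm_mul, Complex.norm_exp, Complex.norm_real, Real.norm_of_nonneg (by positivity)]
      simp
      ring_nf

/-- Over ℂ the generalized eigenspaces span, and decaying solutions can be added. As B is real, the
real part of a complex solution is again a solution. -/
lemma IsStable.exists_decaying_flow {B : Matrix (Fin n) (Fin n) ℝ} (hB : IsStable B)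
    (v : Fin n → ℝ) :
    ∃ u : ℝ → Fin n → ℝ, (∀ t, HasDerivAt u (B *ᵥ u t) t) ∧ u 0 = v ∧ Tendsto u atTop (𝓝 0) := by
  set f : Module.End ℂ (Fin n → ℂ) := Matrix.toLin' (B.map (algebraMap ℝ ℂ)) with hf
  have key : ∀ c : Fin n → ℂ, ∃ u : ℝ → Fin n → ℂ,
      (∀ t, HasDerivAt u (f (u t)) t) ∧ u 0 = c ∧ Tendsto u atTop (𝓝 0) := by
    intro c
    have hc : c ∈ ⨆ μ, f.maxGenEigenspace μ := by
      rw [Module.End.iSup_maxGenEigenspace_eq_top]; trivial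
    induction hc using Submodule.iSup_induction' with
    | mem μ c hc =>
      -- Stability speaks only of eigenvalues. For any other μ the generalized eigenspace is zero,
      -- so c = 0.
      by_cases hμ : f.HasEigenvalue μ
      · have h1 := hμ.mem_spectrum
        rw [hf, Matrix.spectrum_toLin'] at h1
        rw [Module.End.mem_maxGenEigenspace] at hc
        obtain ⟨k, hk⟩ := hc
        refine exists_decaying_flow_of_pow_apply_eq_zero (hB μ h1) (k := k) ?_
        simpa [Algebra.algebraMap_eq_smul_one] using hk
      · refine ⟨0, fun t ↦ by simp, ?_,
          tendsto_const_nhds⟩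
        rw [Module.End.mem_maxGenEigenspace] at hc
        obtain ⟨k, hk⟩ := hc
        have h0 : f.eigenspace μ = ⊥ := by
          by_contra h; exact hμ h
        have hinj : Function.Injective (f - μ • (1 : Module.End ℂ (Fin n → ℂ))) := by
          rw [← LinearMap.ker_eq_bot, ← h0, Module.End.eigenspace_def]
        have : Function.Injective ((f - μ • (1 : Module.End ℂ (Fin n → ℂ))) ^ k) := by
          rw [Module.End.coe_pow]; exact hinj.iterate k
        exact (this (hk.trans (map_zero _).symm)).symm
    | zero =>
      exact ⟨0, fun t ↦ by simp, rfl,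
        tendsto_const_nhds⟩
    | add c d _ _ hc hd =>
      obtain ⟨u, hu, hu0, hul⟩ := hc
      obtain ⟨u', hu', hu0', hul'⟩ := hd
      refine ⟨u + u', fun t ↦ ?_, by simp [hu0, hu0'], ?_⟩
      swap
      · have h := hul.add hul'
        rw [add_zero] at h
        exact h
      simpa using (hu t).add (hu' t)
  obtain ⟨u, hu, hu0, hul⟩ := key (fun i ↦ (v i : ℂ))
  refine ⟨fun t i ↦ (u t i).re, fun t ↦ ?_, ?_, ?_⟩
  · refine hasDerivAt_pi.2 fun i ↦ ?_
    have h1 := hasDerivAt_pi.1 (hu t) i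
    have h2 := (Complex.reCLM.hasFDerivAt (x := u t i)).comp_hasDerivAt t h1
    convert! h2 using 1
    simp [hf, Matrix.mulVec, dotProduct]
  · ext i; simp [hu0]
  · rw [tendsto_pi_nhds] at hul ⊢
    intro i
    have := (Complex.continuous_re.tendsto _).comp (hul i)
    simpa [Function.comp_def] using this

lemma hasDerivAt_dotProduct_mulVec {u v : ℝ → Fin n → ℝ} {u' v' : Fin n → ℝ} {t : ℝ}
    (X : Matrix (Fin n) (Fin n) ℝ) (hu : HasDerivAt u u' t) (hv : HasDerivAt v v' t) :
    HasDerivAt (fun s ↦ u s ⬝ᵥ X *ᵥ v s) (u' ⬝ᵥ X *ᵥ v t + u t ⬝ᵥ X *ᵥ v') t := by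
  rw [hasDerivAt_pi] at hu hv
  simp only [dotProduct, mulVec, ← Finset.sum_add_distrib]
  refine HasDerivAt.fun_sum fun i _ ↦ ?_
  exact (hu i).mul (HasDerivAt.fun_sum fun j _ ↦ (hv j).const_mul _)

/-- The solution of the Lyapunov equation of a stable matrix with right hand side `1` is positive
semidefinite. -/
lemma IsStable.posSemidef_of_solvesLyapunov_one {B X : Matrix (Fin n) (Fin n) ℝ} (hB : IsStable B)
    (hX : SolvesLyapunov B 1 X) : X.PosSemidef := by
  have hsymm : Xᵀ = X := by
    refine (hB.existsUnique_solvesLyapunov 1).unique ?_ hX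
    have := congrArg Matrix.transpose hX
    simp only [transpose_add, transpose_mul, transpose_transpose, transpose_one,
      transpose_zero] at this
    rw [SolvesLyapunov, ← this]
    abel
  refine PosSemidef.of_dotProduct_mulVec_nonneg ?_ fun v ↦ ?_
  · rw [Matrix.IsHermitian, conjTranspose_eq_transpose_of_trivial, hsymm]
  obtain ⟨u, hu, hu0, hul⟩ := hB.exists_decaying_flow v
  -- Along the flow, u ⬝ᵥ X u decreases with rate |u|² and tends to 0, so its initial value v ⬝ᵥ X v
  -- is nonnegative.
  have hd : ∀ t, HasDerivAt (fun s ↦ u s ⬝ᵥ X *ᵥ u s) (-(u t ⬝ᵥ u t)) t := by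
    intro t
    convert hasDerivAt_dotProduct_mulVec X (hu t) (hu t) using 1
    have : u t ⬝ᵥ (Bᵀ * X + X * B + 1) *ᵥ u t = 0 := by
      rw [hX]; simp
    simp only [add_mulVec, dotProduct_add, one_mulVec, ← mulVec_mulVec] at this
    rw [dotProduct_mulVec _ Bᵀ, vecMul_transpose] at this
    linarith
  have hanti : Antitone fun s ↦ u s ⬝ᵥ X *ᵥ u s := by
    refine antitone_of_hasDerivAt_nonpos hd fun t ↦ ?_
    have : 0 ≤ u t ⬝ᵥ u t := by
      simpa using dotProduct_star_self_nonneg (u t)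
    simpa using this
  have hlim : Tendsto (fun s ↦ u s ⬝ᵥ X *ᵥ u s) atTop (𝓝 0) := by
    have hc : Continuous fun y : Fin n → ℝ ↦ y ⬝ᵥ X *ᵥ y := by fun_prop
    simpa [Function.comp_def] using (hc.tendsto 0).comp hul
  have := hanti.le_of_tendsto hlim 0
  simpa [hu0] using this

/-! ### Processes with locally bounded second moments, and Fubini for their products. -/

/-- A real process that is jointly measurable and whose second moments are bounded on bounded
time intervals. -/
structure L2Bounded {Ω : Type*} [MeasurableSpace Ω] (F : ℝ → Ω → ℝ) (P : Measure Ω) : Prop where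
  measurable : Measurable (Function.uncurry F)
  memLp : ∀ t, 0 ≤ t → MemLp (F t) 2 P
  bound : ∀ T, ∃ C, ∀ t ∈ Set.Icc 0 T, ∫ ω, F t ω ^ 2 ∂P ≤ C

variable {Ω : Type*} [MeasurableSpace Ω] {P : Measure Ω}

namespace L2Bounded

variable {F G : ℝ → Ω → ℝ}

lemma add (hF : L2Bounded F P) (hG : L2Bounded G P) : L2Bounded (fun t ω ↦ F t ω + G t ω) P where
  measurable := hF.measurable.add hG.measurable
  memLp t ht := (hF.memLp t ht).add (hG.memLp t ht)
  bound T := by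
    obtain ⟨C, hC⟩ := hF.bound T
    obtain ⟨D, hD⟩ := hG.bound T
    refine ⟨2 * C + 2 * D, fun t ht ↦ ?_⟩
    have h1 := (hF.memLp t ht.1).integrable_sq
    have h2 := (hG.memLp t ht.1).integrable_sq
    calc ∫ ω, (F t ω + G t ω) ^ 2 ∂P ≤ ∫ ω, (2 * F t ω ^ 2 + 2 * G t ω ^ 2) ∂P := by
          refine integral_mono ((hF.memLp t ht.1).add (hG.memLp t ht.1)).integrable_sq
            ((h1.const_mul 2).add (h2.const_mul 2)) fun ω ↦ ?_
          simp only
          nlinarith [sq_nonneg (F t ω - G t ω)]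
      _ = 2 * ∫ ω, F t ω ^ 2 ∂P + 2 * ∫ ω, G t ω ^ 2 ∂P := by
          rw [integral_add (h1.const_mul 2) (h2.const_mul 2), integral_const_mul,
            integral_const_mul]
      _ ≤ _ := by linarith [hC t ht, hD t ht]

lemma const_mul (hF : L2Bounded F P) (c : ℝ) : L2Bounded (fun t ω ↦ c * F t ω) P where
  measurable := hF.measurable.const_mul c
  memLp t ht := (hF.memLp t ht).const_mul c
  bound T := by
    obtain ⟨C, hC⟩ := hF.bound T
    refine ⟨c ^ 2 * C, fun t ht ↦ ?_⟩
    simp_rw [mul_pow]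
    rw [integral_const_mul]
    exact mul_le_mul_of_nonneg_left (hC t ht) (sq_nonneg c)

lemma zero : L2Bounded (fun _ _ ↦ 0) P where
  measurable := measurable_const
  memLp _ _ := MemLp.zero'
  bound _ := ⟨0, fun _ _ ↦ by simp⟩

lemma sum {ι : Type*} (s : Finset ι) {F : ι → ℝ → Ω → ℝ} (hF : ∀ i, L2Bounded (F i) P) :
    L2Bounded (fun t ω ↦ ∑ i ∈ s, F i t ω) P := by
  classical
  induction s using Finset.induction_on with
  | empty => simpa using zero
  | insert i s hi ih =>
    simp_rw [Finset.sum_insert hi]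
    exact (hF i).add ih

lemma const {f : Ω → ℝ} (hf : Measurable f) (hf2 : MemLp f 2 P) : L2Bounded (fun _ ω ↦ f ω) P where
  measurable := hf.comp measurable_snd
  memLp _ _ := hf2
  bound _ := ⟨_, fun _ _ ↦ le_rfl⟩

lemma integrable_mul (hF : L2Bounded F P) (hG : L2Bounded G P) {t : ℝ} (ht : 0 ≤ t) :
    Integrable (fun ω ↦ F t ω * G t ω) P :=
  (hF.memLp t ht).integrable_mul (hG.memLp t ht)

variable [IsProbabilityMeasure P]

/-- The bound |FG| ≤ F² + G² and the uniform second moments on [0, T] make the double integral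
finite. This licenses every later exchange of expectation and time integral over a bounded interval.
-/
lemma integrable_prod_mul (hF : L2Bounded F P) (hG : L2Bounded G P) (T : ℝ) :
    Integrable (Function.uncurry fun t ω ↦ F t ω * G t ω)
      ((volume.restrict (Set.Ioc 0 T)).prod P) := by
  have hm : Measurable (Function.uncurry fun t ω ↦ F t ω * G t ω) :=
    hF.measurable.mul hG.measurable
  obtain ⟨C, hC⟩ := hF.bound T
  obtain ⟨D, hD⟩ := hG.bound T
  rw [integrable_prod_iff hm.aestronglyMeasurable]
  constructor
  · filter_upwards [ae_restrict_mem measurableSet_Ioc] with t ht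
    exact hF.integrable_mul hG ht.1.le
  · refine Integrable.of_bound (C := C + D) ?_ ?_
    · exact (hm.stronglyMeasurable.norm.integral_prod_right (ν := P)).aestronglyMeasurable
    · filter_upwards [ae_restrict_mem measurableSet_Ioc] with t ht
      have ht' : t ∈ Set.Icc 0 T := ⟨ht.1.le, ht.2⟩
      have h1 := (hF.memLp t ht.1.le).integrable_sq
      have h2 := (hG.memLp t ht.1.le).integrable_sq
      rw [Real.norm_of_nonneg (integral_nonneg fun _ ↦ norm_nonneg _)]
      calc ∫ ω, ‖F t ω * G t ω‖ ∂P ≤ ∫ ω, (F t ω ^ 2 + G t ω ^ 2) ∂P := by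
            refine integral_mono (hF.integrable_mul hG ht.1.le).norm (h1.add h2) fun ω ↦ ?_
            simp only [Real.norm_eq_abs, abs_mul]
            nlinarith [sq_nonneg (|F t ω| - |G t ω|), sq_abs (F t ω), sq_abs (G t ω),
              sq_nonneg (F t ω), sq_nonneg (G t ω)]
        _ = ∫ ω, F t ω ^ 2 ∂P + ∫ ω, G t ω ^ 2 ∂P := integral_add h1 h2
        _ ≤ C + D := add_le_add (hC t ht') (hD t ht')

lemma integrable_integral_mul (hF : L2Bounded F P) (hG : L2Bounded G P) {T : ℝ} (hT : 0 ≤ T) :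
    Integrable (fun ω ↦ ∫ t in (0 : ℝ)..T, F t ω * G t ω) P := by
  simp_rw [intervalIntegral.integral_of_le hT]
  exact (hF.integrable_prod_mul hG T).integral_prod_right

lemma integral_integral_mul (hF : L2Bounded F P) (hG : L2Bounded G P) {T : ℝ} (hT : 0 ≤ T) :
    ∫ ω, (∫ t in (0 : ℝ)..T, F t ω * G t ω) ∂P = ∫ t in (0 : ℝ)..T, ∫ ω, F t ω * G t ω ∂P := by
  simp_rw [intervalIntegral.integral_of_le hT]
  exact (integral_integral_swap (hF.integrable_prod_mul hG T)).symm

lemma intervalIntegrable_integral_mul (hF : L2Bounded F P) (hG : L2Bounded G P) {T : ℝ}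
    (hT : 0 ≤ T) : IntervalIntegrable (fun t ↦ ∫ ω, F t ω * G t ω ∂P) volume 0 T := by
  rw [intervalIntegrable_iff_integrableOn_Ioc_of_le hT]
  exact (hF.integrable_prod_mul hG T).integral_prod_left

end L2Bounded

/-! ### Deterministic integral equations and the pathwise energy estimate. -/

section Deterministic

variable {E : Type*} [NormedAddCommGroup E] [NormedSpace ℝ E] [CompleteSpace E]

/-- A solution of an autonomous integral equation is continuous and differentiable. -/
lemma exists_hasDerivAt_of_integral_eq {L : E → E} (hL : Continuous L) {φ : ℝ → E} {T : ℝ}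
    (hT : 0 ≤ T) (hint : IntervalIntegrable (fun s ↦ L (φ s)) volume 0 T)
    (hφ : ∀ t ∈ Set.Icc 0 T, φ t = φ 0 + ∫ s in (0 : ℝ)..t, L (φ s)) :
    ∃ ψ : ℝ → E, Set.EqOn φ ψ (Set.Icc 0 T) ∧ Continuous ψ ∧
      ∀ t ∈ Set.Icc 0 T, HasDerivAt ψ (L (ψ t)) t := by
  have hc : ContinuousOn φ (Set.Icc 0 T) := by
    have h1 := intervalIntegral.continuousOn_primitive_interval' hint Set.left_mem_uIcc
    rw [Set.uIcc_of_le hT] at h1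
    exact (continuousOn_const.add h1).congr hφ
  -- The function φ is controlled on [0, T] only. Clamping time to that interval makes the integrand
  -- continuous on ℝ, so ψ has two-sided derivatives at the endpoints as well.
  let p : ℝ → ℝ := fun s ↦ Set.projIcc 0 T hT s
  have hp : ∀ s ∈ Set.Icc 0 T, p s = s := fun s hs ↦ by
    simp [p, Set.projIcc_of_mem hT hs]
  have hh : Continuous fun s ↦ L (φ (p s)) := by
    refine hL.comp ?_
    exact hc.comp_continuous (by fun_prop) fun s ↦ (Set.projIcc 0 T hT s).2
  let ψ : ℝ → E := fun t ↦ φ 0 + ∫ s in (0 : ℝ)..t, L (φ (p s))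
  have hd : ∀ t, HasDerivAt ψ (L (φ (p t))) t := fun t ↦
    ((hh.integral_hasStrictDerivAt 0 t).hasDerivAt).const_add _
  have heq : Set.EqOn φ ψ (Set.Icc 0 T) := by
    intro t ht
    rw [hφ t ht]
    simp only [ψ]
    congr 1
    refine intervalIntegral.integral_congr fun s hs ↦ ?_
    rw [Set.uIcc_of_le ht.1] at hs
    rw [hp s ⟨hs.1, hs.2.trans ht.2⟩]
  refine ⟨ψ, heq, continuous_iff_continuousAt.2 fun t ↦ (hd t).continuousAt, fun t ht ↦ ?_⟩
  have := hd t
  rwa [hp t ht, heq ht] at this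

/-- The linear integral equation with zero initial value has only the zero solution. -/
lemma eq_zero_of_linear_integral_eq (L : E →L[ℝ] E) {φ : ℝ → E} {T : ℝ}
    (hT : 0 ≤ T) (hint : IntervalIntegrable (fun s ↦ L (φ s)) volume 0 T)
    (hφ : ∀ t ∈ Set.Icc 0 T, φ t = ∫ s in (0 : ℝ)..t, L (φ s)) :
    ∀ t ∈ Set.Icc 0 T, φ t = 0 := by
  have h0 : φ 0 = 0 := by simpa using hφ 0 ⟨le_rfl, hT⟩
  obtain ⟨ψ, heq, hc, hd⟩ := exists_hasDerivAt_of_integral_eq L.continuous hT hint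
    (by simpa [h0] using hφ)
  intro t ht
  have := norm_le_gronwallBound_of_norm_deriv_right_le (f := ψ) (f' := fun t ↦ L (ψ t)) (δ := 0)
    (K := ‖L‖) (ε := 0) (a := 0) (b := T) hc.continuousOn
    (fun t ht ↦ (hd t ⟨ht.1, ht.2.le⟩).hasDerivWithinAt)
    (by rw [← heq ⟨le_rfl, hT⟩, h0, norm_zero]) (fun t _ ↦ by simpa using L.le_opNorm (ψ t)) t ht
  rw [gronwallBound_ε0, zero_mul] at this
  rw [heq ht]
  exact norm_le_zero_iff.1 this

/-- A crude termwise bound by |u i| |v j| ≤ u i ² + v j ². It controls the drift in the energy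
estimate and dominates every quadratic form by a multiple of |x|². -/
lemma abs_dotProduct_mulVec_le (B : Matrix (Fin n) (Fin n) ℝ) (u v : Fin n → ℝ) :
    |u ⬝ᵥ B *ᵥ v| ≤ (∑ i, ∑ j, |B i j|) * (u ⬝ᵥ u + v ⬝ᵥ v) := by
  have hle : ∀ (y : Fin n → ℝ) i, y i ^ 2 ≤ y ⬝ᵥ y := fun y i ↦ by
    rw [pow_two]
    exact Finset.single_le_sum (f := fun i ↦ y i * y i) (fun j _ ↦ mul_self_nonneg _)
      (Finset.mem_univ i)
  simp only [dotProduct, mulVec, Finset.mul_sum]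
  refine (Finset.abs_sum_le_sum_abs _ _).trans ?_
  rw [Finset.sum_mul]
  refine Finset.sum_le_sum fun i _ ↦ (Finset.abs_sum_le_sum_abs _ _).trans ?_
  rw [Finset.sum_mul]
  refine Finset.sum_le_sum fun j _ ↦ ?_
  have h1 := hle u i
  have h2 := hle v j
  simp only [dotProduct] at h1 h2
  rw [abs_mul, abs_mul, mul_left_comm]
  refine mul_le_mul_of_nonneg_left ?_ (abs_nonneg _)
  nlinarith [sq_nonneg (|u i| - |v j|), sq_abs (u i), sq_abs (v j), sq_nonneg (u i),
    sq_nonneg (v j)]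

/-- Energy estimate for `y' = A (y + w)`. -/
lemma dotProduct_self_le_of_integral_eq (A : Matrix (Fin n) (Fin n) ℝ) {x w : ℝ → Fin n → ℝ}
    (hx : Continuous x) (hw : Continuous w)
    (h : ∀ t, 0 ≤ t → x t = x 0 + (∫ s in (0 : ℝ)..t, A *ᵥ x s) + w t) {t : ℝ} (ht : 0 ≤ t) :
    (x t - w t) ⬝ᵥ (x t - w t) ≤ Real.exp (6 * (∑ i, ∑ j, |A i j|) * t) *
      (x 0 ⬝ᵥ x 0 + 2 * (∑ i, ∑ j, |A i j|) * ∫ s in (0 : ℝ)..t, w s ⬝ᵥ w s) := by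
  set C := ∑ i, ∑ j, |A i j| with hC
  have hC0 : 0 ≤ C := Finset.sum_nonneg fun i _ ↦ Finset.sum_nonneg fun j _ ↦ abs_nonneg _
  have hAx : Continuous fun s ↦ A *ᵥ x s := by fun_prop
  have hww : Continuous fun s ↦ w s ⬝ᵥ w s := by fun_prop
  let y : ℝ → Fin n → ℝ := fun t ↦ x 0 + ∫ s in (0 : ℝ)..t, A *ᵥ x s
  have hy : ∀ t, 0 ≤ t → x t = y t + w t := h
  have hyd : ∀ t, HasDerivAt y (A *ᵥ x t) t := fun t ↦
    ((hAx.integral_hasStrictDerivAt 0 t).hasDerivAt).const_add _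
  have hwd : ∀ t, HasDerivAt (fun t ↦ ∫ s in (0 : ℝ)..t, w s ⬝ᵥ w s) (w t ⬝ᵥ w t) t := fun t ↦
    (hww.integral_hasStrictDerivAt 0 t).hasDerivAt
  have hed : ∀ t, HasDerivAt (fun t ↦ Real.exp (-(6 * C * t)))
      (Real.exp (-(6 * C * t)) * -(6 * C)) t := fun t ↦ by
    have : HasDerivAt (fun t : ℝ ↦ -(6 * C * t)) (-(6 * C)) t := by
      simpa using ((hasDerivAt_id t).const_mul (6 * C)).fun_neg
    exact this.exp
  -- The constants come from (|y|²)' = 2 y ⬝ᵥ A (y + w) ≤ 6C |y|² + 2C |w|². The first term is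
  -- cancelled by the exponential weight; the weight is at most 1, so the second is cancelled by the
  -- subtracted integral. The identity matrix only brings |y|² into the form of
  -- `hasDerivAt_dotProduct_mulVec`.
  let k : ℝ → ℝ := fun t ↦ Real.exp (-(6 * C * t)) * (y t ⬝ᵥ (1 : Matrix (Fin n) (Fin n) ℝ) *ᵥ y t)
    - 2 * C * ∫ s in (0 : ℝ)..t, w s ⬝ᵥ w s
  have hkd := fun t ↦ ((hed t).mul (hasDerivAt_dotProduct_mulVec 1 (hyd t) (hyd t))).sub
    ((hwd t).const_mul (2 * C))
  have hk : AntitoneOn k (Set.Ici 0) := by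
    refine antitoneOn_of_hasDerivWithinAt_nonpos (convex_Ici 0)
      (fun t _ ↦ (hkd t).continuousAt.continuousWithinAt)
      (fun t _ ↦ (hkd t).hasDerivWithinAt) fun t ht ↦ ?_
    rw [interior_Ici] at ht
    have h1 : |y t ⬝ᵥ A *ᵥ x t| ≤ C * (3 * (y t ⬝ᵥ y t) + w t ⬝ᵥ w t) := by
      rw [hy t (le_of_lt ht), mulVec_add, dotProduct_add]
      refine (abs_add_le _ _).trans ?_
      have a := abs_dotProduct_mulVec_le A (y t) (y t)
      have b := abs_dotProduct_mulVec_le A (y t) (w t)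
      rw [← hC] at a b
      linarith
    have h2 := le_of_abs_le h1
    have he0 := Real.exp_pos (-(6 * C * t))
    have he1 : Real.exp (-(6 * C * t)) ≤ 1 := by
      rw [Real.exp_le_one_iff]
      have : 0 ≤ t := le_of_lt ht
      have : 0 ≤ 6 * C * t := by positivity
      linarith
    have hw0 : 0 ≤ w t ⬝ᵥ w t := by simpa using dotProduct_star_self_nonneg (w t)
    simp only [one_mulVec]
    rw [dotProduct_comm (A *ᵥ x t) (y t)]
    have h3 := mul_le_mul_of_nonneg_left h2 he0.le
    have h4 := mul_le_mul_of_nonneg_right he1 (mul_nonneg hC0 hw0)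
    nlinarith
  have h5 := hk (Set.mem_Ici.2 le_rfl) (Set.mem_Ici.2 ht) ht
  simp only [k, y, intervalIntegral.integral_same, one_mulVec, mul_zero, neg_zero, Real.exp_zero,
    one_mul, sub_zero, add_zero] at h5
  have h6 : x t - w t = y t := by rw [hy t ht]; simp
  rw [h6]
  have h7 : y t ⬝ᵥ y t = Real.exp (6 * C * t) * (Real.exp (-(6 * C * t)) * (y t ⬝ᵥ y t)) := by
    rw [← mul_assoc, ← Real.exp_add]; simp
  rw [h7]
  refine mul_le_mul_of_nonneg_left ?_ (Real.exp_pos _).le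
  simp only [y]
  linarith

end Deterministic

/-! ### Second moments of a solution and their Lyapunov differential equation. -/

lemma integrable_mul_of_memLp_two {f g : Ω → ℝ} (hf : MemLp f 2 P) (hg : MemLp g 2 P) :
    Integrable (fun ω ↦ f ω * g ω) P :=
  hf.integrable_mul hg

lemma intervalIntegrable_sum {ι : Type*} (s : Finset ι) {f : ι → ℝ → ℝ} {a b : ℝ}
    (hf : ∀ i, IntervalIntegrable (f i) volume a b) :
    IntervalIntegrable (fun t ↦ ∑ i ∈ s, f i t) volume a b := by
  simpa [Finset.sum_fn] using IntervalIntegrable.sum s fun i _ ↦ hf i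

lemma intervalIntegrable_pi {ι : Type*} [Fintype ι] {f : ℝ → ι → ℝ} {a b : ℝ}
    (hf : ∀ i, IntervalIntegrable (fun t ↦ f t i) volume a b) :
    IntervalIntegrable f volume a b := by
  rw [intervalIntegrable_iff]
  exact Integrable.of_eval fun i ↦ intervalIntegrable_iff.1 (hf i)

lemma intervalIntegral_apply {ι : Type*} [Fintype ι] {f : ℝ → ι → ℝ} {a b : ℝ}
    (hf : ∀ i, IntervalIntegrable (fun t ↦ f t i) volume a b) (i : ι) :
    (∫ t in a..b, f t) i = ∫ t in a..b, f t i :=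
  ((ContinuousLinearMap.proj (R := ℝ) (φ := fun _ : ι ↦ ℝ) i).intervalIntegral_comp_comm
    (intervalIntegrable_pi hf)).symm

/-- A solution of `dx = A x dt + dw` all of whose paths are continuous and satisfy the integral
equation, together with the second order properties of the initial value and of the noise `w`. -/
structure SecondOrderSolution (A V : Matrix (Fin n) (Fin n) ℝ) (w x : ℝ → Ω → Fin n → ℝ)
    (P : Measure Ω) : Prop where
  cont_x : ∀ ω, Continuous fun t ↦ x t ω
  cont_w : ∀ ω, Continuous fun t ↦ w t ω
  meas_x : ∀ t, Measurable (x t)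
  meas_w : ∀ t, Measurable (w t)
  eq : ∀ ω t, 0 ≤ t → x t ω = x 0 ω + (∫ s in (0 : ℝ)..t, A *ᵥ x s ω) + w t ω
  memLp_x_zero : ∀ i, MemLp (fun ω ↦ x 0 ω i) 2 P
  memLp_w : ∀ t, 0 ≤ t → ∀ i, MemLp (fun ω ↦ w t ω i) 2 P
  integral_w_mul_w : ∀ t, 0 ≤ t → ∀ i j, ∫ ω, w t ω i * w t ω j ∂P = t * V i j
  integral_w_mul_sub : ∀ s r t, 0 ≤ s → s ≤ r → r ≤ t → ∀ i j,
    ∫ ω, w s ω i * (w t ω j - w r ω j) ∂P = 0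
  integral_x_zero_mul_sub : ∀ r t, 0 ≤ r → r ≤ t → ∀ i j,
    ∫ ω, x 0 ω i * (w t ω j - w r ω j) ∂P = 0

namespace SecondOrderSolution

variable {A V : Matrix (Fin n) (Fin n) ℝ} {w x : ℝ → Ω → Fin n → ℝ}

lemma measurable_uncurry {z : ℝ → Ω → Fin n → ℝ} (hc : ∀ ω, Continuous fun t ↦ z t ω)
    (hm : ∀ t, Measurable (z t)) (i : Fin n) :
    Measurable (Function.uncurry fun t ω ↦ z t ω i) :=
  measurable_uncurry_of_continuous_of_measurable
    (fun ω ↦ (continuous_apply i).comp (hc ω)) fun t ↦ (measurable_pi_apply i).comp (hm t)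

lemma l2Bounded_w (h : SecondOrderSolution A V w x P) (i : Fin n) :
    L2Bounded (fun t ω ↦ w t ω i) P where
  measurable := measurable_uncurry h.cont_w h.meas_w i
  memLp t ht := h.memLp_w t ht i
  bound T := by
    refine ⟨T * |V i i|, fun t ht ↦ ?_⟩
    simp_rw [pow_two]
    rw [h.integral_w_mul_w t ht.1]
    calc t * V i i ≤ t * |V i i| := mul_le_mul_of_nonneg_left (le_abs_self _) ht.1
      _ ≤ T * |V i i| := mul_le_mul_of_nonneg_right ht.2 (abs_nonneg _)

lemma w_zero (h : SecondOrderSolution A V w x P) (ω : Ω) : w 0 ω = 0 := by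
  simpa using h.eq ω 0 le_rfl

/-- The finite variation part of the solution, in integrated form. -/
lemma sub_apply_eq (h : SecondOrderSolution A V w x P) (ω : Ω) {t : ℝ} (ht : 0 ≤ t) (i : Fin n) :
    x t ω i - w t ω i = x 0 ω i + ∫ s in (0 : ℝ)..t, ∑ k, A i k * x s ω k := by
  have hc : Continuous fun s ↦ A *ᵥ x s ω := by
    have := h.cont_x ω
    fun_prop
  have h1 := congrFun (h.eq ω t ht) i
  simp only [Pi.add_apply] at h1
  rw [h1, intervalIntegral_apply (f := fun s ↦ A *ᵥ x s ω) fun i ↦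
    ((continuous_apply i).comp hc).intervalIntegrable 0 t]
  simp [mulVec, dotProduct]

variable [IsProbabilityMeasure P]

/-- The energy estimate bounds |x - w|² by a random variable `R T` built from |x(0)|² and the
integral of |w|². It is integrable, and being monotone in time it serves all t ≤ T at once. -/
lemma l2Bounded_sub (h : SecondOrderSolution A V w x P) (i : Fin n) :
    L2Bounded (fun t ω ↦ x t ω i - w t ω i) P := by
  set C := ∑ i, ∑ j, |A i j| with hC
  have hC0 : 0 ≤ C := Finset.sum_nonneg fun i _ ↦ Finset.sum_nonneg fun j _ ↦ abs_nonneg _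
  let R : ℝ → Ω → ℝ := fun T ω ↦ Real.exp (6 * C * T) *
    (x 0 ω ⬝ᵥ x 0 ω + 2 * C * ∫ s in (0 : ℝ)..T, w s ω ⬝ᵥ w s ω)
  have hR : ∀ T, 0 ≤ T → Integrable (R T) P := by
    intro T hT
    refine Integrable.const_mul (Integrable.add ?_ (Integrable.const_mul ?_ _)) _
    · simp only [dotProduct]
      exact integrable_finsetSum _ fun k _ ↦
        (h.memLp_x_zero k).integrable_mul (h.memLp_x_zero k)
    · simp only [dotProduct]
      have : ∀ ω, ∫ s in (0 : ℝ)..T, ∑ k, w s ω k * w s ω k =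
          ∑ k, ∫ s in (0 : ℝ)..T, w s ω k * w s ω k := fun ω ↦ by
        refine intervalIntegral.integral_finsetSum fun k _ ↦ Continuous.intervalIntegrable ?_ _ _
        have := h.cont_w ω
        fun_prop
      simp_rw [this]
      exact integrable_finsetSum _ fun k _ ↦
        (h.l2Bounded_w k).integrable_integral_mul (h.l2Bounded_w k) hT
  have hle : ∀ T, ∀ t ∈ Set.Icc 0 T, ∀ ω, (x t ω i - w t ω i) ^ 2 ≤ R T ω := by
    intro T t ht ω
    have h1 := dotProduct_self_le_of_integral_eq A (h.cont_x ω) (h.cont_w ω) (h.eq ω) ht.1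
    have h2 : (x t ω i - w t ω i) ^ 2 ≤ (x t ω - w t ω) ⬝ᵥ (x t ω - w t ω) := by
      rw [pow_two]
      exact Finset.single_le_sum (f := fun i ↦ (x t ω - w t ω) i * (x t ω - w t ω) i)
        (fun j _ ↦ mul_self_nonneg _) (Finset.mem_univ i)
    refine (h2.trans h1).trans ?_
    have hn : ∀ y : Fin n → ℝ, 0 ≤ y ⬝ᵥ y := fun y ↦ by
      simpa using dotProduct_star_self_nonneg y
    have hcw : Continuous fun s ↦ w s ω ⬝ᵥ w s ω := by
      have := h.cont_w ω
      fun_prop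
    have h3 : ∫ s in (0 : ℝ)..t, w s ω ⬝ᵥ w s ω ≤ ∫ s in (0 : ℝ)..T, w s ω ⬝ᵥ w s ω :=
      intervalIntegral.integral_mono_interval le_rfl ht.1 ht.2
        (Eventually.of_forall fun s ↦ hn _) (hcw.intervalIntegrable _ _)
    have h4 : 0 ≤ ∫ s in (0 : ℝ)..t, w s ω ⬝ᵥ w s ω :=
      intervalIntegral.integral_nonneg ht.1 fun s _ ↦ hn _
    have h5 := hn (x 0 ω)
    have h6 : 6 * C * t ≤ 6 * C * T := mul_le_mul_of_nonneg_left ht.2 (by positivity)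
    simp only [R, ← hC]
    gcongr
  have hm : ∀ t, Measurable fun ω ↦ x t ω i - w t ω i := fun t ↦
    ((measurable_pi_apply i).comp (h.meas_x t)).sub ((measurable_pi_apply i).comp (h.meas_w t))
  have hL : ∀ t, 0 ≤ t → MemLp (fun ω ↦ x t ω i - w t ω i) 2 P := by
    intro t ht
    rw [memLp_two_iff_integrable_sq (hm t).aestronglyMeasurable]
    refine (hR t ht).mono' ((hm t).pow_const 2).aestronglyMeasurable
      (Eventually.of_forall fun ω ↦ ?_)
    rw [Real.norm_of_nonneg (sq_nonneg _)]
    exact hle t t ⟨ht, le_rfl⟩ ω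
  refine ⟨(measurable_uncurry h.cont_x h.meas_x i).sub (measurable_uncurry h.cont_w h.meas_w i),
    hL, fun T ↦ ⟨∫ ω, R T ω ∂P, fun t ht ↦ ?_⟩⟩
  exact integral_mono (hL t ht.1).integrable_sq (hR T (ht.1.trans ht.2)) (hle T t ht)

lemma l2Bounded_x (h : SecondOrderSolution A V w x P) (i : Fin n) :
    L2Bounded (fun t ω ↦ x t ω i) P := by
  simpa using (h.l2Bounded_sub i).add (h.l2Bounded_w i)

lemma l2Bounded_drift (h : SecondOrderSolution A V w x P) (i : Fin n) :
    L2Bounded (fun t ω ↦ ∑ k, A i k * x t ω k) P :=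
  L2Bounded.sum _ fun k ↦ (h.l2Bounded_x k).const_mul _

lemma integral_drift_mul (h : SecondOrderSolution A V w x P) {F : ℝ → Ω → ℝ} (hF : L2Bounded F P)
    {s : ℝ} (hs : 0 ≤ s) (i : Fin n) :
    ∫ ω, (∑ k, A i k * x s ω k) * F s ω ∂P = ∑ k, A i k * ∫ ω, x s ω k * F s ω ∂P := by
  simp_rw [Finset.sum_mul, mul_assoc]
  rw [integral_finsetSum _ fun k _ ↦ ((h.l2Bounded_x k).integrable_mul hF hs).const_mul _]
  simp_rw [integral_const_mul]

/-- The finite variation part against a random variable `D`. -/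
lemma integral_sub_mul (h : SecondOrderSolution A V w x P) {D : Ω → ℝ} (hD : Measurable D)
    (hD2 : MemLp D 2 P) {t : ℝ} (ht : 0 ≤ t) (i : Fin n) :
    ∫ ω, (x t ω i - w t ω i) * D ω ∂P = ∫ ω, x 0 ω i * D ω ∂P +
      ∫ s in (0 : ℝ)..t, ∫ ω, (∑ k, A i k * x s ω k) * D ω ∂P := by
  have hDL := L2Bounded.const hD hD2
  rw [← (h.l2Bounded_drift i).integral_integral_mul hDL ht,
    ← integral_add (integrable_mul_of_memLp_two (h.memLp_x_zero i) hD2)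
      ((h.l2Bounded_drift i).integrable_integral_mul hDL ht)]
  refine integral_congr_ae (Eventually.of_forall fun ω ↦ ?_)
  simp only
  rw [h.sub_apply_eq ω ht i, add_mul, intervalIntegral.integral_mul_const]

/-- The solution is uncorrelated with later increments of the noise. -/
lemma integral_x_mul_sub (h : SecondOrderSolution A V w x P) {s r t : ℝ} (hs : 0 ≤ s) (hsr : s ≤ r)
    (hrt : r ≤ t) (i j : Fin n) : ∫ ω, x s ω i * (w t ω j - w r ω j) ∂P = 0 := by
  have hr := hs.trans hsr
  set D : Ω → ℝ := fun ω ↦ w t ω j - w r ω j with hD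
  have hDm : Measurable D :=
    ((measurable_pi_apply j).comp (h.meas_w t)).sub ((measurable_pi_apply j).comp (h.meas_w r))
  have hD2 : MemLp D 2 P := (h.memLp_w t (hr.trans hrt) j).sub (h.memLp_w r hr j)
  have hDL := L2Bounded.const hDm hD2
  let L : (Fin n → ℝ) →L[ℝ] (Fin n → ℝ) := LinearMap.toContinuousLinearMap (Matrix.mulVecLin A)
  have hLa : ∀ v, L v = A *ᵥ v := fun v ↦ rfl
  -- Both x(0) and w(s) are uncorrelated with D, so g(s) = E[x(s) D] satisfies the homogeneous
  -- equation g(s) = ∫₀ˢ A g and must vanish.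
  let g : ℝ → Fin n → ℝ := fun s i ↦ ∫ ω, x s ω i * D ω ∂P
  have hgi : ∀ i, IntervalIntegrable (fun s ↦ L (g s) i) volume 0 r := fun i ↦ by
    simp only [hLa, g, mulVec, dotProduct]
    exact intervalIntegrable_sum _ fun k ↦
      ((h.l2Bounded_x k).intervalIntegrable_integral_mul hDL hr).const_mul _
  have key : ∀ s ∈ Set.Icc 0 r, g s = ∫ τ in (0 : ℝ)..s, L (g τ) := by
    intro s hs
    ext i
    rw [intervalIntegral_apply fun i ↦ (hgi i).mono_set (Set.uIcc_subset_uIcc_left (by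
      rw [Set.uIcc_of_le hr]; exact hs))]
    have h3 := h.integral_sub_mul hDm hD2 hs.1 i
    rw [h.integral_x_zero_mul_sub r t hr hrt i j, zero_add] at h3
    have h4 : ∫ ω, (x s ω i - w s ω i) * D ω ∂P = g s i := by
      simp_rw [sub_mul]
      rw [integral_sub ((h.l2Bounded_x i).integrable_mul hDL hs.1)
        ((h.l2Bounded_w i).integrable_mul hDL hs.1),
        h.integral_w_mul_sub s r t hs.1 hs.2 hrt i j, sub_zero]
    rw [← h4, h3]
    refine intervalIntegral.integral_congr fun τ hτ ↦ ?_
    rw [Set.uIcc_of_le hs.1] at hτ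
    exact h.integral_drift_mul hDL hτ.1 i
  exact congrFun (eq_zero_of_linear_integral_eq L hr (intervalIntegrable_pi hgi) key s ⟨hs, hsr⟩) i

lemma integral_x_mul_w (h : SecondOrderSolution A V w x P) {s t : ℝ} (hs : 0 ≤ s) (hst : s ≤ t)
    (i j : Fin n) : ∫ ω, x s ω i * w t ω j ∂P = ∫ ω, x s ω i * w s ω j ∂P := by
  have h1 := h.integral_x_mul_sub hs le_rfl hst i j
  simp_rw [mul_sub] at h1
  rw [integral_sub (integrable_mul_of_memLp_two ((h.l2Bounded_x i).memLp s hs)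
    (h.memLp_w t (hs.trans hst) j)) ((h.l2Bounded_x i).integrable_mul
    (h.l2Bounded_w j) hs)] at h1
  exact sub_eq_zero.1 h1

/-- By Fubini, w(t) is paired with A x(s) for s ≤ t, and only the part w(s) of w(t) correlates with
x(s). -/
lemma integral_sub_mul_w (h : SecondOrderSolution A V w x P) {t : ℝ} (ht : 0 ≤ t) (i j : Fin n) :
    ∫ ω, (x t ω i - w t ω i) * w t ω j ∂P =
      ∫ s in (0 : ℝ)..t, ∫ ω, (∑ k, A i k * x s ω k) * w s ω j ∂P := by
  have hm : Measurable fun ω ↦ w t ω j := (measurable_pi_apply j).comp (h.meas_w t)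
  have h0 : ∫ ω, x 0 ω i * w t ω j ∂P = 0 := by
    have := h.integral_x_zero_mul_sub 0 t le_rfl ht i j
    simpa [h.w_zero] using this
  rw [h.integral_sub_mul hm (h.memLp_w t ht j) ht i]
  rw [h0, zero_add]
  refine intervalIntegral.integral_congr fun s hs ↦ ?_
  rw [Set.uIcc_of_le ht] at hs
  have h1 := h.integral_drift_mul (L2Bounded.const hm (h.memLp_w t ht j)) hs.1 i
  rw [h1, h.integral_drift_mul (h.l2Bounded_w j) hs.1 i]
  simp_rw [h.integral_x_mul_w hs.1 hs.2]

/-- The paths of x - w are continuously differentiable, so this is the ordinary product rule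
followed by Fubini; no Itô correction appears. -/
lemma integral_sub_mul_sub (h : SecondOrderSolution A V w x P) {t : ℝ} (ht : 0 ≤ t) (i j : Fin n) :
    ∫ ω, (x t ω i - w t ω i) * (x t ω j - w t ω j) ∂P = ∫ ω, x 0 ω i * x 0 ω j ∂P +
      ((∫ s in (0 : ℝ)..t, ∫ ω, (∑ k, A i k * x s ω k) * (x s ω j - w s ω j) ∂P) +
      ∫ s in (0 : ℝ)..t, ∫ ω, (∑ k, A j k * x s ω k) * (x s ω i - w s ω i) ∂P) := by
  rw [← (h.l2Bounded_drift i).integral_integral_mul (h.l2Bounded_sub j) ht,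
    ← (h.l2Bounded_drift j).integral_integral_mul (h.l2Bounded_sub i) ht,
    ← integral_add ((h.l2Bounded_drift i).integrable_integral_mul (h.l2Bounded_sub j) ht)
      ((h.l2Bounded_drift j).integrable_integral_mul (h.l2Bounded_sub i) ht),
    ← integral_add (integrable_mul_of_memLp_two (h.memLp_x_zero i) (h.memLp_x_zero j))
      (((h.l2Bounded_drift i).integrable_integral_mul (h.l2Bounded_sub j) ht).fun_add
      ((h.l2Bounded_drift j).integrable_integral_mul (h.l2Bounded_sub i) ht))]
  refine integral_congr_ae (Eventually.of_forall fun ω ↦ ?_)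
  simp only
  have hcx := h.cont_x ω
  have hcw := h.cont_w ω
  have hd : ∀ i, Continuous fun s ↦ ∑ k, A i k * x s ω k := fun i ↦ by fun_prop
  let y : Fin n → ℝ → ℝ := fun i t ↦ x 0 ω i + ∫ s in (0 : ℝ)..t, ∑ k, A i k * x s ω k
  have hyd : ∀ i t, HasDerivAt (y i) (∑ k, A i k * x t ω k) t := fun i t ↦
    ((hd i).integral_hasStrictDerivAt 0 t).hasDerivAt.const_add _
  have hyc : ∀ i, Continuous (y i) := fun i ↦
    continuous_iff_continuousAt.2 fun t ↦ (hyd i t).continuousAt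
  have hy : ∀ i t, 0 ≤ t → x t ω i - w t ω i = y i t := fun i t ht ↦ h.sub_apply_eq ω ht i
  have hftc := intervalIntegral.integral_eq_sub_of_hasDerivAt (a := 0) (b := t)
    (fun s _ ↦ (hyd i s).mul (hyd j s))
    ((((hd i).mul (hyc j)).add ((hyc i).mul (hd j))).intervalIntegrable _ _)
  have hI : ∀ i j, Continuous fun s ↦ (∑ k, A i k * x s ω k) * (x s ω j - w s ω j) :=
    fun i j ↦ by fun_prop
  rw [← intervalIntegral.integral_add ((hI i j).intervalIntegrable _ _)
    ((hI j i).intervalIntegrable _ _), hy i t ht, hy j t ht]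
  have h0 : ∀ i, y i 0 = x 0 ω i := fun i ↦ by simp [y]
  simp only [Pi.mul_apply, h0] at hftc
  refine (sub_eq_iff_eq_add'.1 hftc.symm).trans (congrArg _ ?_)
  refine intervalIntegral.integral_congr fun s hs ↦ ?_
  rw [Set.uIcc_of_le ht] at hs
  rw [hy i s hs.1, hy j s hs.1, mul_comm (y i s)]

/-- The second moments of the solution satisfy the Lyapunov differential equation, in integrated
form. -/
lemma secondMoment_eq (h : SecondOrderSolution A V w x P) {t : ℝ} (ht : 0 ≤ t) (i j : Fin n) :
    secondMoment (x t) P i j = secondMoment (x 0) P i j + ∫ s in (0 : ℝ)..t,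
      (A * secondMoment (x s) P + secondMoment (x s) P * Aᵀ + V) i j := by
  have hyy := h.integral_sub_mul_sub ht i j
  have hyw := h.integral_sub_mul_w ht i j
  have hwy := h.integral_sub_mul_w ht j i
  have hww := h.integral_w_mul_w t ht i j
  have i1 := (h.l2Bounded_sub i).integrable_mul (h.l2Bounded_sub j) ht
  have i2 := (h.l2Bounded_sub i).integrable_mul (h.l2Bounded_w j) ht
  have i3 := (h.l2Bounded_sub j).integrable_mul (h.l2Bounded_w i) ht
  have i4 := (h.l2Bounded_w i).integrable_mul (h.l2Bounded_w j) ht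
  -- Expand x = (x - w) + w in both factors. The last term, E[w wᵀ] = t V, is the only source of V.
  have hsplit : ∫ ω, x t ω i * x t ω j ∂P = ∫ ω, (x t ω i - w t ω i) * (x t ω j - w t ω j) ∂P +
      (∫ ω, (x t ω i - w t ω i) * w t ω j ∂P + (∫ ω, (x t ω j - w t ω j) * w t ω i ∂P +
      ∫ ω, w t ω i * w t ω j ∂P)) := by
    rw [← integral_add i3 i4, ← integral_add i2 (i3.fun_add i4),
      ← integral_add i1 (i2.fun_add (i3.fun_add i4))]
    refine integral_congr_ae (Eventually.of_forall fun ω ↦ ?_)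
    ring
  -- The drift paired with x - w and the drift paired with w recombine into the drift paired with x.
  have hdrift : ∀ i j, (∫ s in (0 : ℝ)..t, ∫ ω, (∑ k, A i k * x s ω k) * (x s ω j - w s ω j) ∂P) +
      ∫ s in (0 : ℝ)..t, ∫ ω, (∑ k, A i k * x s ω k) * w s ω j ∂P =
      ∫ s in (0 : ℝ)..t, ∑ k, A i k * ∫ ω, x s ω k * x s ω j ∂P := by
    intro i j
    rw [← intervalIntegral.integral_add
      ((h.l2Bounded_drift i).intervalIntegrable_integral_mul (h.l2Bounded_sub j) ht)
      ((h.l2Bounded_drift i).intervalIntegrable_integral_mul (h.l2Bounded_w j) ht)]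
    refine intervalIntegral.integral_congr fun s hs ↦ ?_
    rw [Set.uIcc_of_le ht] at hs
    rw [← h.integral_drift_mul (h.l2Bounded_x j) hs.1,
      ← integral_add ((h.l2Bounded_drift i).integrable_mul (h.l2Bounded_sub j) hs.1)
      ((h.l2Bounded_drift i).integrable_mul (h.l2Bounded_w j) hs.1)]
    refine integral_congr_ae (Eventually.of_forall fun ω ↦ ?_)
    simp only
    ring
  have hint : ∀ i j, IntervalIntegrable (fun s ↦ ∑ k, A i k * ∫ ω, x s ω k * x s ω j ∂P)
      volume 0 t := fun i j ↦ intervalIntegrable_sum _ fun k ↦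
    ((h.l2Bounded_x k).intervalIntegrable_integral_mul (h.l2Bounded_x j) ht).const_mul _
  have hrhs : ∫ s in (0 : ℝ)..t, (A * secondMoment (x s) P + secondMoment (x s) P * Aᵀ + V) i j =
      (∫ s in (0 : ℝ)..t, ∑ k, A i k * ∫ ω, x s ω k * x s ω j ∂P) +
      (∫ s in (0 : ℝ)..t, ∑ k, A j k * ∫ ω, x s ω k * x s ω i ∂P) + t * V i j := by
    have hV : t * V i j = ∫ s in (0 : ℝ)..t, V i j := by simp
    rw [hV, ← intervalIntegral.integral_add (hint i j) (hint j i),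
      ← intervalIntegral.integral_add ((hint i j).add (hint j i)) intervalIntegrable_const]
    refine intervalIntegral.integral_congr fun s _ ↦ ?_
    simp only [secondMoment, Matrix.add_apply, Matrix.mul_apply, of_apply, transpose_apply]
    congr 2
    refine Finset.sum_congr rfl fun k _ ↦ ?_
    rw [mul_comm]
    simp_rw [mul_comm (x s _ i)]
  rw [hrhs, ← hdrift, ← hdrift]
  simp only [secondMoment, of_apply]
  rw [hsplit, hyy, hyw, hwy, hww]
  ring

lemma intervalIntegrable_secondMoment (h : SecondOrderSolution A V w x P) {t : ℝ} (ht : 0 ≤ t)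
    (i j : Fin n) : IntervalIntegrable (fun s ↦ secondMoment (x s) P i j) volume 0 t := by
  simpa [secondMoment] using
    (h.l2Bounded_x i).intervalIntegrable_integral_mul (h.l2Bounded_x j) ht

end SecondOrderSolution

/-! ### Discounted second moments and the expected cost. -/

lemma trace_mul_secondMoment (X : Matrix (Fin n) (Fin n) ℝ) {z : Ω → Fin n → ℝ}
    (hz : ∀ i j, Integrable (fun ω ↦ z ω i * z ω j) P) :
    (X * secondMoment z P).trace = ∫ ω, z ω ⬝ᵥ X *ᵥ z ω ∂P := by
  simp only [trace, diag_apply, Matrix.mul_apply, secondMoment, of_apply, dotProduct, mulVec,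
    Finset.mul_sum]
  rw [integral_finsetSum _ fun i _ ↦ integrable_finsetSum _ fun j _ ↦ by
    simpa only [mul_left_comm] using (hz i j).const_mul (X i j)]
  refine Finset.sum_congr rfl fun i _ ↦ ?_
  rw [integral_finsetSum _ fun j _ ↦ by
    simpa only [mul_left_comm] using (hz i j).const_mul (X i j)]
  refine Finset.sum_congr rfl fun j _ ↦ ?_
  rw [← integral_const_mul]
  congr 1
  ext ω
  ring

namespace SecondOrderSolution

variable {A V : Matrix (Fin n) (Fin n) ℝ} {w x : ℝ → Ω → Fin n → ℝ} [IsProbabilityMeasure P]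

lemma trace_mul_secondMoment_eq (h : SecondOrderSolution A V w x P)
    (X : Matrix (Fin n) (Fin n) ℝ) {t : ℝ} (ht : 0 ≤ t) :
    (X * secondMoment (x t) P).trace = ∫ ω, x t ω ⬝ᵥ X *ᵥ x t ω ∂P :=
  trace_mul_secondMoment X fun i j ↦ (h.l2Bounded_x i).integrable_mul (h.l2Bounded_x j) ht

/-- On a bounded time interval the second moments agree with a continuously differentiable
solution of the Lyapunov differential equation. -/
lemma exists_hasDerivAt_secondMoment (h : SecondOrderSolution A V w x P) {T : ℝ} (hT : 0 ≤ T) :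
    ∃ S : ℝ → Matrix (Fin n) (Fin n) ℝ,
      (∀ t ∈ Set.Icc 0 T, secondMoment (x t) P = S t) ∧
      (∀ i j, Continuous fun t ↦ S t i j) ∧
      ∀ t ∈ Set.Icc 0 T, ∀ i j,
        HasDerivAt (fun t ↦ S t i j) ((A * S t + S t * Aᵀ + V) i j) t := by
  let toM : (Fin n × Fin n → ℝ) → Matrix (Fin n) (Fin n) ℝ := fun m ↦ Matrix.of fun i j ↦ m (i, j)
  let L : (Fin n × Fin n → ℝ) → (Fin n × Fin n → ℝ) := fun m p ↦
    (A * toM m + toM m * Aᵀ + V) p.1 p.2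
  have hL : Continuous L := by
    refine continuous_pi fun p ↦ ?_
    simp only [L, toM, Matrix.add_apply, Matrix.mul_apply, of_apply]
    fun_prop
  let φ : ℝ → (Fin n × Fin n → ℝ) := fun t p ↦ secondMoment (x t) P p.1 p.2
  have hφM : ∀ t, toM (φ t) = secondMoment (x t) P := fun t ↦ rfl
  have hint : ∀ p, IntervalIntegrable (fun s ↦ L (φ s) p) volume 0 T := by
    intro p
    simp only [L, hφM, Matrix.add_apply, Matrix.mul_apply]
    exact ((intervalIntegrable_sum _ fun k ↦
      (h.intervalIntegrable_secondMoment hT k p.2).const_mul _).add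
      (intervalIntegrable_sum _ fun k ↦
      (h.intervalIntegrable_secondMoment hT p.1 k).mul_const _)).add intervalIntegrable_const
  obtain ⟨ψ, heq, hc, hd⟩ := exists_hasDerivAt_of_integral_eq hL hT (intervalIntegrable_pi hint)
    (φ := φ) fun t ht ↦ by
      ext p
      rw [Pi.add_apply, intervalIntegral_apply fun p ↦ (hint p).mono_set
        (Set.uIcc_subset_uIcc_left (by rw [Set.uIcc_of_le hT]; exact ht))]
      exact h.secondMoment_eq ht.1 p.1 p.2
  refine ⟨fun t ↦ toM (ψ t), fun t ht ↦ ?_, fun i j ↦ (continuous_apply (i, j)).comp hc,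
    fun t ht i j ↦ hasDerivAt_pi.1 (hd t ht) (i, j)⟩
  simp only
  rw [← heq ht, hφM]

lemma continuousOn_secondMoment (h : SecondOrderSolution A V w x P) (i j : Fin n) :
    ContinuousOn (fun t ↦ secondMoment (x t) P i j) (Set.Ici 0) := by
  intro t ht
  obtain ⟨S, hS, hc, -⟩ := h.exists_hasDerivAt_secondMoment (T := t + 1)
    (by linarith [Set.mem_Ici.1 ht])
  have h1 : ContinuousOn (fun t ↦ secondMoment (x t) P i j) (Set.Icc 0 (t + 1)) :=
    (hc i j).continuousOn.congr fun s hs ↦ by rw [hS s hs]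
  refine (h1 t ⟨ht, by linarith⟩).mono_of_mem_nhdsWithin ?_
  rw [← Set.Ici_inter_Iic]
  exact inter_mem_nhdsWithin _ (Iic_mem_nhds (by linarith))

lemma hasDerivAt_secondMoment (h : SecondOrderSolution A V w x P) {t : ℝ} (ht : 0 < t)
    (i j : Fin n) : HasDerivAt (fun t ↦ secondMoment (x t) P i j)
      ((A * secondMoment (x t) P + secondMoment (x t) P * Aᵀ + V) i j) t := by
  obtain ⟨S, hS, -, hd⟩ := h.exists_hasDerivAt_secondMoment (T := t + 1) (by linarith)
  rw [hS t ⟨ht.le, by linarith⟩]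
  refine (hd t ⟨ht.le, by linarith⟩ i j).congr_of_eventuallyEq ?_
  filter_upwards [Icc_mem_nhds ht (by linarith : t < t + 1)] with s hs
  rw [hS s hs]

lemma continuousOn_trace_mul (h : SecondOrderSolution A V w x P) (X : Matrix (Fin n) (Fin n) ℝ) :
    ContinuousOn (fun t ↦ (X * secondMoment (x t) P).trace) (Set.Ici 0) := by
  simp only [trace, diag_apply, Matrix.mul_apply]
  exact continuousOn_finsetSum _ fun i _ ↦ continuousOn_finsetSum _ fun j _ ↦
    continuousOn_const.mul (h.continuousOn_secondMoment j i)

/-- The discounted quadratic form of a solution of the Lyapunov equation along the second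
moments. -/
lemma hasDerivAt_exp_mul_trace (h : SecondOrderSolution A V w x P) {α : ℝ}
    {Q X : Matrix (Fin n) (Fin n) ℝ} (hX : SolvesLyapunov (shift A α) Q X) {t : ℝ} (ht : 0 < t) :
    HasDerivAt (fun t ↦ Real.exp (2 * α * t) * (X * secondMoment (x t) P).trace)
      (Real.exp (2 * α * t) * ((X * V).trace - (Q * secondMoment (x t) P).trace)) t := by
  set S := secondMoment (x t) P with hS
  have h1 : HasDerivAt (fun t ↦ (X * secondMoment (x t) P).trace)
      (X * (A * S + S * Aᵀ + V)).trace t := by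
    have hXM : ∀ M : Matrix (Fin n) (Fin n) ℝ, (X * M).trace = ∑ i, ∑ j, X i j * M j i :=
      fun M ↦ by simp only [trace, diag_apply, Matrix.mul_apply]
    simp_rw [hXM]
    exact HasDerivAt.fun_sum fun i _ ↦ HasDerivAt.fun_sum fun j _ ↦
      (h.hasDerivAt_secondMoment ht j i).const_mul _
  have h2 : HasDerivAt (fun t ↦ Real.exp (2 * α * t)) (Real.exp (2 * α * t) * (2 * α)) t := by
    simpa using ((hasDerivAt_id t).const_mul (2 * α)).exp
  refine (h2.fun_mul h1).congr_deriv ?_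
  -- Expressing Q through the shifted equation lets the factor 2α from the exponential cancel
  -- against the two α I terms of the shift.
  have hQ : Q = -((A + α • (1 : Matrix (Fin n) (Fin n) ℝ))ᵀ * X +
      X * (A + α • (1 : Matrix (Fin n) (Fin n) ℝ))) := (neg_eq_of_add_eq_zero_right hX).symm
  have h3 : (X * (S * Aᵀ)).trace = (Aᵀ * X * S).trace := by
    rw [← mul_assoc, trace_mul_comm, mul_assoc]
  rw [hQ, ← hS]
  simp only [mul_add, add_mul, trace_add, transpose_add, transpose_smul, transpose_one, neg_mul,
    trace_neg, smul_mul_assoc, one_mul, mul_smul_comm, mul_one, trace_smul, smul_eq_mul, h3,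
    ← mul_assoc X A S]
  ring

lemma continuousOn_exp_mul_trace (h : SecondOrderSolution A V w x P) (α : ℝ)
    (X : Matrix (Fin n) (Fin n) ℝ) :
    ContinuousOn (fun t ↦ Real.exp (2 * α * t) * (X * secondMoment (x t) P).trace) (Set.Ici 0) :=
  ContinuousOn.mul (by fun_prop) (h.continuousOn_trace_mul X)

/-- The discounted mean energy is integrable over all times if `A + α` is stable. -/
lemma integrableOn_exp_mul_trace_one (h : SecondOrderSolution A V w x P) {α : ℝ} (hα : α < 0)
    (hA : IsStable (shift A α)) :
    IntegrableOn (fun t ↦ Real.exp (2 * α * t) *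
      ((1 : Matrix (Fin n) (Fin n) ℝ) * secondMoment (x t) P).trace) (Set.Ioi 0) := by
  obtain ⟨X, hX, -⟩ := hA.existsUnique_solvesLyapunov 1
  have hpos := hA.posSemidef_of_solvesLyapunov_one hX
  set p : ℝ → ℝ := fun t ↦ Real.exp (2 * α * t) *
      ((1 : Matrix (Fin n) (Fin n) ℝ) * secondMoment (x t) P).trace with hp
  have hpc : ContinuousOn p (Set.Ici 0) := h.continuousOn_exp_mul_trace α 1
  have hp0 : ∀ t, 0 ≤ t → 0 ≤ p t := by
    intro t ht
    simp only [hp]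
    rw [h.trace_mul_secondMoment_eq 1 ht]
    refine mul_nonneg (Real.exp_pos _).le (integral_nonneg fun ω ↦ ?_)
    simpa using dotProduct_star_self_nonneg (x t ω)
  let q : ℝ → ℝ := fun t ↦ Real.exp (2 * α * t) * (X * secondMoment (x t) P).trace
  have hq0 : ∀ t, 0 ≤ t → 0 ≤ q t := by
    intro t ht
    simp only [q]
    rw [h.trace_mul_secondMoment_eq X ht]
    refine mul_nonneg (Real.exp_pos _).le (integral_nonneg fun ω ↦ ?_)
    simpa using hpos.dotProduct_mulVec_nonneg (x t ω)
  set v := (X * V).trace with hv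
  -- An antiderivative of p: the first summand integrates e^{2αt} tr(XV). Since q ≥ 0 and e^{2αt} ≤
  -- 1, it is bounded above on t ≥ 0 by |v / (2α)|, so the integrals of p over [0, T] stay bounded.
  let r : ℝ → ℝ := fun t ↦ Real.exp (2 * α * t) * (v / (2 * α)) - q t
  have hrd : ∀ t, 0 < t → HasDerivAt r (p t) t := by
    intro t ht
    have h2 : HasDerivAt (fun t ↦ Real.exp (2 * α * t)) (Real.exp (2 * α * t) * (2 * α)) t := by
      simpa using ((hasDerivAt_id t).const_mul (2 * α)).exp
    refine ((h2.mul_const (v / (2 * α))).fun_sub (h.hasDerivAt_exp_mul_trace hX ht)).congr_deriv ?_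
    simp only [hp, ← hv]
    field_simp [hα.ne]
    ring
  have hrc : ContinuousOn r (Set.Ici 0) :=
    ContinuousOn.sub (by fun_prop) (h.continuousOn_exp_mul_trace α X)
  have hpi : ∀ T, 0 ≤ T → IntervalIntegrable p volume 0 T := fun T hT ↦
    (hpc.mono (by rw [Set.uIcc_of_le hT]; exact Set.Icc_subset_Ici_self)).intervalIntegrable
  refine integrableOn_Ioi_of_intervalIntegral_norm_bounded (|v / (2 * α)| - r 0) 0
    (b := fun T : ℝ ↦ max T 0) (l := atTop) (fun T ↦ ?_)
    (tendsto_atTop_mono (fun T ↦ le_max_left T 0) tendsto_id) ?_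
  · rw [← intervalIntegrable_iff_integrableOn_Ioc_of_le (le_max_right _ _)]
    exact hpi _ (le_max_right _ _)
  · filter_upwards [eventually_ge_atTop 0] with T hT
    rw [max_eq_left hT]
    have h1 : ∫ t in (0 : ℝ)..T, ‖p t‖ = ∫ t in (0 : ℝ)..T, p t := by
      refine intervalIntegral.integral_congr fun t ht ↦ ?_
      rw [Set.uIcc_of_le hT] at ht
      exact Real.norm_of_nonneg (hp0 t ht.1)
    rw [h1, intervalIntegral.integral_eq_sub_of_hasDerivAt_of_le hT
      (hrc.mono Set.Icc_subset_Ici_self) (fun t ht ↦ hrd t ht.1) (hpi T hT)]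
    refine sub_le_sub_right ?_ _
    have h2 : Real.exp (2 * α * T) ≤ 1 := by
      rw [Real.exp_le_one_iff]
      nlinarith
    calc r T ≤ Real.exp (2 * α * T) * (v / (2 * α)) := sub_le_self _ (hq0 T hT)
      _ ≤ Real.exp (2 * α * T) * |v / (2 * α)| :=
        mul_le_mul_of_nonneg_left (le_abs_self _) (Real.exp_pos _).le
      _ ≤ |v / (2 * α)| := mul_le_of_le_one_left (abs_nonneg _) h2

lemma integrable_dotProduct_mulVec (h : SecondOrderSolution A V w x P)
    (Q : Matrix (Fin n) (Fin n) ℝ) {t : ℝ} (ht : 0 ≤ t) :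
    Integrable (fun ω ↦ x t ω ⬝ᵥ Q *ᵥ x t ω) P := by
  simp only [dotProduct, mulVec, Finset.mul_sum]
  refine integrable_finsetSum _ fun i _ ↦ integrable_finsetSum _ fun j _ ↦ ?_
  simpa only [mul_left_comm] using
    ((h.l2Bounded_x i).integrable_mul (h.l2Bounded_x j) ht).const_mul (Q i j)

/-- The discounted running cost is integrable in time and chance. -/
lemma integrable_prod_exp_mul_dotProduct (h : SecondOrderSolution A V w x P) {α : ℝ} (hα : α < 0)
    (hA : IsStable (shift A α)) (Q : Matrix (Fin n) (Fin n) ℝ) :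
    Integrable (Function.uncurry fun t ω ↦ Real.exp (2 * α * t) * (x t ω ⬝ᵥ Q *ᵥ x t ω))
      ((volume.restrict (Set.Ioi 0)).prod P) := by
  have hm : Measurable
      (Function.uncurry fun t ω ↦ Real.exp (2 * α * t) * (x t ω ⬝ᵥ Q *ᵥ x t ω)) := by
    refine Measurable.mul (f := fun p : ℝ × Ω ↦ Real.exp (2 * α * p.1)) (by fun_prop) ?_
    simp only [dotProduct, mulVec]
    refine Finset.measurable_fun_sum _ fun i _ ↦ (h.l2Bounded_x i).measurable.mul
      (Finset.measurable_fun_sum _ fun j _ ↦ (h.l2Bounded_x j).measurable.const_mul _)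
  rw [integrable_prod_iff hm.aestronglyMeasurable]
  constructor
  · filter_upwards [ae_restrict_mem measurableSet_Ioi] with t ht
    exact (h.integrable_dotProduct_mulVec Q (le_of_lt ht)).const_mul (Real.exp (2 * α * t))
  -- Domination by the case Q = 1; the factor 2 arises from `abs_dotProduct_mulVec_le` with both
  -- vectors equal to x.
  · refine ((h.integrableOn_exp_mul_trace_one hα hA).const_mul
      (2 * ∑ i, ∑ j, |Q i j|)).mono' ?_ ?_
    · exact (hm.stronglyMeasurable.norm.integral_prod_right (ν := P)).aestronglyMeasurable
    · filter_upwards [ae_restrict_mem measurableSet_Ioi] with t ht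
      have ht0 : 0 ≤ t := le_of_lt ht
      rw [Real.norm_of_nonneg (integral_nonneg fun _ ↦ norm_nonneg _),
        h.trace_mul_secondMoment_eq 1 ht0, ← integral_const_mul, ← integral_const_mul]
      refine integral_mono ((h.integrable_dotProduct_mulVec Q ht0).const_mul
        (Real.exp (2 * α * t))).norm
        (((h.integrable_dotProduct_mulVec 1 ht0).const_mul _).const_mul _) fun ω ↦ ?_
      simp only [Function.uncurry_apply_pair, norm_mul, Real.norm_eq_abs, Real.abs_exp,
        one_mulVec]
      have := mul_le_mul_of_nonneg_left (abs_dotProduct_mulVec_le Q (x t ω) (x t ω))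
        (Real.exp_pos (2 * α * t)).le
      linarith

lemma integrableOn_exp_mul_trace (h : SecondOrderSolution A V w x P) {α : ℝ} (hα : α < 0)
    (hA : IsStable (shift A α)) (Q : Matrix (Fin n) (Fin n) ℝ) :
    IntegrableOn (fun t ↦ Real.exp (2 * α * t) * (Q * secondMoment (x t) P).trace)
      (Set.Ioi 0) := by
  refine (h.integrable_prod_exp_mul_dotProduct hα hA Q).integral_prod_left.congr ?_
  filter_upwards [ae_restrict_mem measurableSet_Ioi] with t ht
  simp only [Function.uncurry_apply_pair]
  rw [h.trace_mul_secondMoment_eq Q (le_of_lt ht), integral_const_mul]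

/-- Integrate the derivative of e^{2αt} tr(XS(t)) over (0, ∞). The boundary term at infinity
vanishes because this function and its derivative are both integrable. -/
lemma setIntegral_exp_mul_trace (h : SecondOrderSolution A V w x P) {α : ℝ} (hα : α < 0)
    (hA : IsStable (shift A α)) {Q X : Matrix (Fin n) (Fin n) ℝ}
    (hX : SolvesLyapunov (shift A α) Q X) :
    ∫ t in Set.Ioi (0 : ℝ), Real.exp (2 * α * t) * (Q * secondMoment (x t) P).trace =
      ((secondMoment (x 0) P - (1 / (2 * α)) • V) * X).trace := by
  have hα2 : 2 * α < 0 := by linarith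
  have hexp : IntegrableOn (fun t ↦ Real.exp (2 * α * t) * (X * V).trace) (Set.Ioi 0) :=
    (integrableOn_exp_mul_Ioi hα2 0).mul_const _
  have hQ := h.integrableOn_exp_mul_trace hα hA Q
  have hd' : IntegrableOn (fun t ↦ Real.exp (2 * α * t) *
      ((X * V).trace - (Q * secondMoment (x t) P).trace)) (Set.Ioi 0) := by
    simpa only [mul_sub] using hexp.fun_sub hQ
  have hlim := tendsto_zero_of_hasDerivAt_of_integrableOn_Ioi
    (fun t ht ↦ h.hasDerivAt_exp_mul_trace hX ht) hd' (h.integrableOn_exp_mul_trace hα hA X)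
  have hint := integral_Ioi_of_hasDerivAt_of_tendsto
    (h.continuousOn_exp_mul_trace α X 0 Set.self_mem_Ici)
    (fun t ht ↦ h.hasDerivAt_exp_mul_trace hX ht) hd' hlim
  simp only [mul_sub] at hint
  rw [integral_sub hexp hQ, integral_mul_const, integral_exp_mul_Ioi hα2] at hint
  simp only [mul_zero, Real.exp_zero, one_mul, zero_sub] at hint
  rw [sub_mul, trace_sub, smul_mul_assoc, trace_smul, trace_mul_comm _ X, trace_mul_comm V X,
    smul_eq_mul]
  have : -1 / (2 * α) = -(1 / (2 * α)) := by ring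
  rw [this] at hint
  linarith

lemma integral_cost (h : SecondOrderSolution A V w x P) {α : ℝ} (hα : α < 0)
    (hA : IsStable (shift A α)) {Q X : Matrix (Fin n) (Fin n) ℝ}
    (hX : SolvesLyapunov (shift A α) Q X) :
    ∫ ω, (∫ t in Set.Ioi (0 : ℝ), Real.exp (2 * α * t) * (x t ω ⬝ᵥ Q *ᵥ x t ω)) ∂P =
      ((secondMoment (x 0) P - (1 / (2 * α)) • V) * X).trace := by
  rw [← integral_integral_swap (h.integrable_prod_exp_mul_dotProduct hα hA Q),
    ← h.setIntegral_exp_mul_trace hα hA hX]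
  refine setIntegral_congr_fun measurableSet_Ioi fun t ht ↦ ?_
  rw [h.trace_mul_secondMoment_eq Q (le_of_lt ht), integral_const_mul]

end SecondOrderSolution

/-! ### Moments of Brownian motion and passage to well-behaved versions. -/

/-- A process that has continuous paths on a measurable set `s` and agrees there with measurable
functions at a dense sequence of times is measurable on `s`. -/
lemma measurable_indicator_of_continuous {T E : Type*} [TopologicalSpace T]
    [TopologicalSpace.SeparableSpace T] [FrechetUrysohnSpace T] [Nonempty T]
    [TopologicalSpace E] [TopologicalSpace.PseudoMetrizableSpace E] [MeasurableSpace E]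
    [BorelSpace E] [Zero E] {z : T → Ω → E} {s : Set Ω} (hs : MeasurableSet s)
    (hc : ∀ ω ∈ s, Continuous fun t ↦ z t ω) {y : ℕ → Ω → E} (hy : ∀ k, Measurable (y k))
    (hzy : ∀ ω ∈ s, ∀ k, z (TopologicalSpace.denseSeq T k) ω = y k ω) (t : T) :
    Measurable (s.indicator (z t)) := by
  have h1 : ∀ k, Measurable (s.indicator (z (TopologicalSpace.denseSeq T k))) := by
    intro k
    have : s.indicator (z (TopologicalSpace.denseSeq T k)) = s.indicator (y k) :=
      Set.indicator_congr fun ω hω ↦ hzy ω hω k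
    rw [this]
    exact (hy k).indicator hs
  obtain ⟨u, hu, hut⟩ := mem_closure_iff_seq_limit.1 (TopologicalSpace.denseRange_denseSeq T t)
  choose k hk using hu
  refine measurable_of_tendsto_metrizable (f := fun m ↦ s.indicator (z (u m))) (fun m ↦ ?_) ?_
  · rw [← hk m]
    exact h1 _
  · rw [tendsto_pi_nhds]
    intro ω
    by_cases hω : ω ∈ s
    · simpa [hω, Function.comp_def] using ((hc ω hω).tendsto t).comp hut
    · simpa [hω] using tendsto_const_nhds

namespace IsBrownianMotion

variable {V : Matrix (Fin n) (Fin n) ℝ} {w : ℝ≥0 → Ω → Fin n → ℝ}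

lemma memLp_sub (h : IsBrownianMotion V w P) {s t : ℝ≥0} (hst : s ≤ t) (i : Fin n) :
    MemLp (fun ω ↦ w t ω i - w s ω i) 2 P := by
  have h1 := (h.law s t hst).hasGaussianLaw.memLp_two
  exact (EuclideanSpace.proj (𝕜 := ℝ) i).comp_memLp' h1

lemma integral_sub (h : IsBrownianMotion V w P) {s t : ℝ≥0} (hst : s ≤ t) (i : Fin n) :
    ∫ ω, (w t ω i - w s ω i) ∂P = 0 := by
  have h1 := (h.law s t hst).integral_comp (f := fun y : EuclideanSpace ℝ (Fin n) ↦ y i)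
    (by fun_prop)
  have h2 := (EuclideanSpace.proj (𝕜 := ℝ) i).integral_comp_comm
    (IsGaussian.integrable_id (μ := multivariateGaussian 0 (((t : ℝ) - (s : ℝ)) • V)))
  simp only [id_eq, integral_id_multivariateGaussian, map_zero] at h2
  exact h1.trans h2

lemma integral_sub_mul_sub (h : IsBrownianMotion V w P) {s t : ℝ≥0} (hst : s ≤ t) (i j : Fin n) :
    ∫ ω, (w t ω i - w s ω i) * (w t ω j - w s ω j) ∂P = ((t : ℝ) - s) * V i j := by
  have h1 := (h.law s t hst).covariance_comp (f := fun y : EuclideanSpace ℝ (Fin n) ↦ y i)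
    (g := fun y : EuclideanSpace ℝ (Fin n) ↦ y j) (by fun_prop) (by fun_prop)
  rw [covariance_eval_multivariateGaussian
    (h.posSemidef.smul (sub_nonneg.2 (NNReal.coe_le_coe.2 hst)))] at h1
  simp only [covariance, Function.comp_def, Pi.sub_apply, h.integral_sub hst, sub_zero,
    Matrix.smul_apply, smul_eq_mul] at h1
  exact h1

lemma apply_eq_sub (h : IsBrownianMotion V w P) (t : ℝ≥0) :
    ∀ᵐ ω ∂P, ∀ i, w t ω i = w t ω i - w 0 ω i := by
  filter_upwards [h.zero] with ω hω i
  simp [hω]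

lemma memLp (h : IsBrownianMotion V w P) (t : ℝ≥0) (i : Fin n) :
    MemLp (fun ω ↦ w t ω i) 2 P :=
  (memLp_congr_ae ((h.apply_eq_sub t).mono fun _ hω ↦ hω i)).2 (h.memLp_sub zero_le i)

lemma integral_mul (h : IsBrownianMotion V w P) (t : ℝ≥0) (i j : Fin n) :
    ∫ ω, w t ω i * w t ω j ∂P = t * V i j := by
  have := h.integral_sub_mul_sub (zero_le (a := t)) i j
  rw [NNReal.coe_zero, sub_zero] at this
  rw [← this]
  refine integral_congr_ae ?_
  filter_upwards [h.zero] with ω hω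
  simp [hω]

lemma aemeasurable (h : IsBrownianMotion V w P) (t : ℝ≥0) : AEMeasurable (w t) P :=
  aemeasurable_pi_iff.2 fun i ↦ (h.memLp t i).aestronglyMeasurable.aemeasurable

/-- Independence of increments is applied to increments that start at s; the increment from r to t
is a difference of two of these. -/
lemma integral_mul_sub (h : IsBrownianMotion V w P) {s r t : ℝ≥0} (hsr : s ≤ r) (hrt : r ≤ t)
    (i j : Fin n) : ∫ ω, w s ω i * (w t ω j - w r ω j) ∂P = 0 := by
  have h1 : ∀ u, s ≤ u → ∫ ω, w s ω i * (w u ω j - w s ω j) ∂P = 0 := by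
    intro u hu
    have hi := (h.indep.indepFun_eval_sub zero_le hu h.zero).comp
      (measurable_pi_apply i) (measurable_pi_apply j)
    have := hi.integral_fun_mul_eq_mul_integral (h.memLp s i).aestronglyMeasurable
      (h.memLp_sub hu j).aestronglyMeasurable
    simp only [Function.comp_apply, Pi.sub_apply] at this
    rw [this, h.integral_sub hu, mul_zero]
  have hint : ∀ u, s ≤ u → Integrable (fun ω ↦ w s ω i * (w u ω j - w s ω j)) P :=
    fun u hu ↦ integrable_mul_of_memLp_two (h.memLp s i) (h.memLp_sub hu j)
  have h2 := MeasureTheory.integral_sub (hint t (hsr.trans hrt)) (hint r hsr)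
  rw [h1 t (hsr.trans hrt), h1 r hsr, sub_zero] at h2
  rw [← h2]
  congr 1
  ext ω
  ring

lemma integral_mul_sub_of_indepFun (h : IsBrownianMotion V w P) {z : Ω → Fin n → ℝ}
    (hz : AEMeasurable z P) (hzw : IndepFun z (fun ω t ↦ w t ω) P) {r t : ℝ≥0} (hrt : r ≤ t)
    (i j : Fin n) : ∫ ω, z ω i * (w t ω j - w r ω j) ∂P = 0 := by
  have hi := hzw.comp (ψ := fun f : ℝ≥0 → Fin n → ℝ ↦ f t j - f r j) (measurable_pi_apply i)
    (by fun_prop)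
  have := hi.integral_fun_mul_eq_mul_integral (aemeasurable_pi_iff.1 hz i).aestronglyMeasurable
    (h.memLp_sub hrt j).aestronglyMeasurable
  simp only [Function.comp_apply] at this
  rw [this, h.integral_sub hrt, mul_zero]

end IsBrownianMotion

/-- A solution agrees almost surely with one all of whose paths are well behaved. -/
lemma IsSolution.exists_secondOrderSolution {A V : Matrix (Fin n) (Fin n) ℝ}
    {w x : ℝ≥0 → Ω → Fin n → ℝ} (hx : IsSolution A w x P) (hw : IsBrownianMotion V w P)
    (hx₀ : HasGaussianLaw (x 0) P) (hindep : IndepFun (x 0) (fun ω t ↦ w t ω) P) :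
    ∃ x' w' : ℝ≥0 → Ω → Fin n → ℝ, (∀ᵐ ω ∂P, ∀ t, x' t ω = x t ω) ∧
      SecondOrderSolution A V (fun t ↦ w' t.toNNReal) (fun t ↦ x' t.toNNReal) P := by
  -- Measurable versions can be matched almost surely at countably many times only; path continuity
  -- carries measurability from this dense sequence to all times.
  let d := TopologicalSpace.denseSeq ℝ≥0
  have hgood : ∀ᵐ ω ∂P, Continuous (fun t ↦ x t ω) ∧ Continuous (fun t ↦ w t ω) ∧
      (∀ t : ℝ≥0, x t ω = x 0 ω + (∫ s in (0 : ℝ)..t, A *ᵥ x s.toNNReal ω) + w t ω) ∧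
      (∀ k, x (d k) ω = (hx.aemeasurable (d k)).mk _ ω) ∧
      ∀ k, w (d k) ω = (hw.aemeasurable (d k)).mk _ ω := by
    filter_upwards [hx.cont, hw.cont, hx.eq,
      ae_all_iff.2 fun k ↦ (hx.aemeasurable (d k)).ae_eq_mk,
      ae_all_iff.2 fun k ↦ (hw.aemeasurable (d k)).ae_eq_mk] with ω h1 h2 h3 h4 h5
    exact ⟨h1, h2, h3, h4, h5⟩
  obtain ⟨G, hG, hGm, hGp⟩ := hgood.exists_measurable_mem
  -- Outside G both processes are set to 0, where continuity and the integral equation hold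
  -- trivially.
  let x' : ℝ≥0 → Ω → Fin n → ℝ := fun t ↦ G.indicator (x t)
  let w' : ℝ≥0 → Ω → Fin n → ℝ := fun t ↦ G.indicator (w t)
  have hx' : ∀ ω ∈ G, ∀ t, x' t ω = x t ω := fun ω hω t ↦ Set.indicator_of_mem hω _
  have hw' : ∀ ω ∈ G, ∀ t, w' t ω = w t ω := fun ω hω t ↦ Set.indicator_of_mem hω _
  have hx'0 : ∀ ω ∉ G, ∀ t, x' t ω = 0 := fun ω hω t ↦ Set.indicator_of_notMem hω _
  have hw'0 : ∀ ω ∉ G, ∀ t, w' t ω = 0 := fun ω hω t ↦ Set.indicator_of_notMem hω _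
  have hxc : ∀ ω, Continuous fun t ↦ x' t ω := by
    intro ω
    by_cases hω : ω ∈ G
    · simpa only [hx' ω hω] using (hGp ω hω).1
    · simpa only [hx'0 ω hω] using continuous_const
  have hwc : ∀ ω, Continuous fun t ↦ w' t ω := by
    intro ω
    by_cases hω : ω ∈ G
    · simpa only [hw' ω hω] using (hGp ω hω).2.1
    · simpa only [hw'0 ω hω] using continuous_const
  have hxae : ∀ᵐ ω ∂P, ∀ t, x' t ω = x t ω := by
    filter_upwards [hG] with ω hω using hx' ω hω
  have hwae : ∀ᵐ ω ∂P, ∀ t, w' t ω = w t ω := by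
    filter_upwards [hG] with ω hω using hw' ω hω
  refine ⟨x', w', hxae, ?_⟩
  constructor
  · exact fun ω ↦ (hxc ω).comp continuous_real_toNNReal
  · exact fun ω ↦ (hwc ω).comp continuous_real_toNNReal
  · exact fun t ↦ measurable_indicator_of_continuous hGm (fun ω hω ↦ (hGp ω hω).1)
      (fun k ↦ (hx.aemeasurable (d k)).measurable_mk) (fun ω hω ↦ (hGp ω hω).2.2.2.1) _
  · exact fun t ↦ measurable_indicator_of_continuous hGm (fun ω hω ↦ (hGp ω hω).2.1)
      (fun k ↦ (hw.aemeasurable (d k)).measurable_mk) (fun ω hω ↦ (hGp ω hω).2.2.2.2) _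
  · intro ω t ht
    by_cases hω : ω ∈ G
    · have := (hGp ω hω).2.2.1 t.toNNReal
      rw [Real.coe_toNNReal t ht] at this
      simpa only [hx' ω hω, hw' ω hω, Real.toNNReal_zero] using this
    · simp [hx'0 ω hω, hw'0 ω hω]
  · intro i
    have h1 : MemLp (fun ω ↦ x 0 ω i) 2 P :=
      (ContinuousLinearMap.proj (R := ℝ) (φ := fun _ : Fin n ↦ ℝ) i).comp_memLp' hx₀.memLp_two
    refine (memLp_congr_ae ?_).2 h1
    filter_upwards [hxae] with ω hω
    simp [hω]
  · intro t _ i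
    refine (memLp_congr_ae ?_).2 (hw.memLp t.toNNReal i)
    filter_upwards [hwae] with ω hω
    simp [hω]
  · intro t ht i j
    have := hw.integral_mul t.toNNReal i j
    rw [Real.coe_toNNReal t ht] at this
    rw [← this]
    refine integral_congr_ae ?_
    filter_upwards [hwae] with ω hω
    simp [hω]
  · intro s r t _ hsr hrt i j
    refine (integral_congr_ae ?_).trans (hw.integral_mul_sub (Real.toNNReal_le_toNNReal hsr)
      (Real.toNNReal_le_toNNReal hrt) i j)
    filter_upwards [hwae] with ω hω
    simp [hω]
  · intro r t _ hrt i j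
    refine (integral_congr_ae ?_).trans (hw.integral_mul_sub_of_indepFun hx₀.aemeasurable hindep
      (Real.toNNReal_le_toNNReal hrt) i j)
    filter_upwards [hwae, hxae] with ω hω hω'
    simp [hω, hω']

end LinearSDE

/-! ### The theorem, transferred from the well-behaved version to the given process. -/

theorem theorem2 {n : ℕ} {Ω : Type*} [MeasurableSpace Ω] (P : Measure Ω) [IsProbabilityMeasure P]
    (A V Q : Matrix (Fin n) (Fin n) ℝ) (α : ℝ) (w x : ℝ≥0 → Ω → Fin n → ℝ)
    (hQ : Q.IsSymm)
    (hw : LinearSDE.IsBrownianMotion V w P)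
    (hx : LinearSDE.IsSolution A w x P)
    (hx₀ : HasGaussianLaw (x 0) P)
    (hindep : IndepFun (x 0) (fun ω t ↦ w t ω) P)
    (hα : α < 0)
    (hA : LinearSDE.IsStable (LinearSDE.shift A α)) :
    (∃! X, LinearSDE.SolvesLyapunov (LinearSDE.shift A α) Q X) ∧
    (∀ᵐ ω ∂P, IntegrableOn (LinearSDE.runningCost α Q x ω) (Set.Ioi 0)) ∧
    Integrable (LinearSDE.cost α Q x) P ∧
    ∀ X, LinearSDE.SolvesLyapunov (LinearSDE.shift A α) Q X →
      ∫ ω, LinearSDE.cost α Q x ω ∂P =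
        ((LinearSDE.secondMoment (x 0) P - (1 / (2 * α)) • V) * X).trace := by
  obtain ⟨x', w', hxx', h⟩ := hx.exists_secondOrderSolution hw hx₀ hindep
  have hprod := h.integrable_prod_exp_mul_dotProduct hα hA Q
  have hrun : ∀ᵐ ω ∂P, LinearSDE.runningCost α Q x ω = LinearSDE.runningCost α Q x' ω := by
    filter_upwards [hxx'] with ω hω
    ext t
    simp only [LinearSDE.runningCost, hω]
  have hcost : LinearSDE.cost α Q x =ᵐ[P] LinearSDE.cost α Q x' := by
    filter_upwards [hrun] with ω hω
    simp only [LinearSDE.cost, hω]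
  refine ⟨hA.existsUnique_solvesLyapunov Q, ?_, ?_, fun X hX ↦ ?_⟩
  · filter_upwards [hrun, hprod.prod_left_ae] with ω hω hi
    rw [hω]
    exact hi
  · exact hprod.integral_prod_right.congr hcost.symm
  · have hmom : LinearSDE.secondMoment (x 0) P =
        LinearSDE.secondMoment (x' (0 : ℝ).toNNReal) P := by
      ext i j
      simp only [LinearSDE.secondMoment, of_apply]
      refine integral_congr_ae ?_
      filter_upwards [hxx'] with ω hω
      simp [hω]
    rw [integral_congr_ae hcost, hmom]
    exact h.integral_cost hα hA hX
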